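/- Let $A\in\mathbb R^{N\times d}$, $A\neq 0$, let $b,\tilde b\in\mathbb R^N$ with $b,\tilde b\notin\mathrm{range}(A)$, and let $\|\cdot\|$ be the Euclidean norm. For every $m$ let $S=S_m\in\mathbb R^{m\times N}$ be a Gaussian sketch, i.e. a random matrix with i.i.d. $\mathcal N(0,1/m)$ entries. For $a\in\{b,\tilde b\}$ put $r(A,a)=\min_x\|Ax-a\|$ and $r_S(A,a)=\|A\hat x-a\|$, where $\hat x=(SA)^\dagger Sa$ is the (minimum-norm) minimizer of $\|SAx-Sa\|$ over $x\in\mathbb R^d$, and let $$\mu(a,S)=\sqrt{\frac{r_S(A,a)^2-r(A,a)^2}{r(A,a)^2}} .$$ Write $\mathrm{corr}(X,Y)=\mathrm{Cov}(X,Y)/\sqrt{\mathbb V[X]\,\mathbb V[Y]}$ for Pearson's correlation coefficient, $P$ and $P_\perp$ for the orthogonal projections onto $\mathrm{range}(A)$ and onto its orthogonal complement, and $a_{\mathcal P}=a/\|a\|$. Then, for all sufficiently large $m$, $\mu^2(b,S)$ and $\mu^2(\tilde b,S)$ have finite second moments and positive variances (so that their correlation is well defined), and $$\liminf_{m\to\infty}\mathrm{corr}\big(\mu^2(b,S),\mu^2(\tilde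 b,S)\big)\ \ge\ \frac{\|P_\perp b_{\mathcal P}\|^2-\sqrt6\,\min\{\|P_\perp(b_{\mathcal P}+\tilde b_{\mathcal P})\|,\|P_\perp(b_{\mathcal P}-\tilde b_{\mathcal P})\|\}}{\|P_\perp\tilde b_{\mathcal P}\|^2}.$$ Moreover, if $$\varphi:=\frac{|\langle b,\tilde b\rangle|}{\|b\|\,\|\tilde b\|}\ >\ \kappa:=\frac{\|Pb\|}{\|b\|},$$ then $$\liminf_{m\to\infty}\mathrm{corr}\big(\mu^2(b,S),\mu^2(\tilde b,S)\big)\ \ge\ (1-\kappa^2)-\frac{\sqrt{12(1-\varphi)}}{(\varphi-\kappa)^2}.$$ -/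

import Mathlib

open MeasureTheory ProbabilityTheory Filter
open scoped NNReal

namespace BiFidelity

/-- `x` solves the least squares problem `min_z ‖B z - y‖₂`. -/
def IsLeastSquaresSolution {m d : ℕ} (B : Matrix (Fin m) (Fin d) ℝ)
    (y : EuclideanSpace ℝ (Fin m)) (x : EuclideanSpace ℝ (Fin d)) : Prop :=
  ∀ z : EuclideanSpace ℝ (Fin d),
    ‖Matrix.toEuclideanLin B x - y‖ ≤ ‖Matrix.toEuclideanLin B z - y‖

/-- A least squares problem has a solution of least norm. -/
theorem exists_minNorm_leastSquares {m d : ℕ} (B : Matrix (Fin m) (Fin d) ℝ)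
    (y : EuclideanSpace ℝ (Fin m)) :
    ∃ x : EuclideanSpace ℝ (Fin d), IsLeastSquaresSolution B y x ∧
      ∀ x', IsLeastSquaresSolution B y x' → ‖x‖ ≤ ‖x'‖ := by
  set T := Matrix.toEuclideanLin B with hT
  have hclosed : IsClosed {x : EuclideanSpace ℝ (Fin d) | IsLeastSquaresSolution B y x} := by
    have hc : Continuous T := T.continuous_of_finiteDimensional
    simp only [IsLeastSquaresSolution, Set.ofPred_forall]
    exact isClosed_iInter fun z => isClosed_le (by fun_prop) continuous_const
  have hne : {x : EuclideanSpace ℝ (Fin d) | IsLeastSquaresSolution B y x}.Nonempty := by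
    obtain ⟨x, hx⟩ : (LinearMap.range T).starProjection y ∈ LinearMap.range T :=
      Submodule.starProjection_apply_mem _ y
    refine ⟨x, fun z => ?_⟩
    rw [← hT, hx, norm_sub_rev, norm_sub_rev _ y, Submodule.starProjection_minimal]
    exact ciInf_le ⟨0, by rintro _ ⟨w, rfl⟩; positivity⟩
      (⟨T z, LinearMap.mem_range_self T z⟩ : LinearMap.range T)
  obtain ⟨x, hx, hmin⟩ := hclosed.exists_infDist_eq_dist hne 0
  refine ⟨x, hx, fun x' hx' => ?_⟩
  have h := Metric.infDist_le_dist_of_mem (x := (0 : EuclideanSpace ℝ (Fin d)))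
    (show x' ∈ {x | IsLeastSquaresSolution B y x} from hx')
  rw [hmin] at h
  simpa using h

/-- The least squares solution `argmin_z ‖B z - y‖₂ = B† y`: the minimiser, taken of least norm
when there are several. -/
noncomputable def leastSquaresSolution {m d : ℕ} (B : Matrix (Fin m) (Fin d) ℝ)
    (y : EuclideanSpace ℝ (Fin m)) : EuclideanSpace ℝ (Fin d) :=
  (exists_minNorm_leastSquares B y).choose

/-- The optimal residual `r(A, b) = min_x ‖A x - b‖₂`. -/
noncomputable def residual {N d : ℕ} (A : Matrix (Fin N) (Fin d) ℝ)
    (b : EuclideanSpace ℝ (Fin N)) : ℝ :=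
  ⨅ x : EuclideanSpace ℝ (Fin d), ‖Matrix.toEuclideanLin A x - b‖

/-- The residual `r_S(A, b) = ‖A x̂ - b‖₂` of the sketched solution
`x̂ = argmin_x ‖S A x - S b‖₂`. -/
noncomputable def sketchedResidual {m N d : ℕ} (S : Matrix (Fin m) (Fin N) ℝ)
    (A : Matrix (Fin N) (Fin d) ℝ) (b : EuclideanSpace ℝ (Fin N)) : ℝ :=
  ‖Matrix.toEuclideanLin A
    (leastSquaresSolution (S * A) (Matrix.toEuclideanLin S b)) - b‖

/-- The optimality coefficient `μ_A(b, S)`. -/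
noncomputable def optimalityCoeff {m N d : ℕ} (A : Matrix (Fin N) (Fin d) ℝ)
    (b : EuclideanSpace ℝ (Fin N)) (S : Matrix (Fin m) (Fin N) ℝ) : ℝ :=
  Real.sqrt ((sketchedResidual S A b ^ 2 - residual A b ^ 2) / residual A b ^ 2)

/-- Pearson's correlation coefficient. -/
noncomputable def pearsonCorr {Ω : Type*} [MeasurableSpace Ω] (X Y : Ω → ℝ)
    (P : Measure Ω) : ℝ :=
  cov[X, Y; P] / Real.sqrt (Var[X; P] * Var[Y; P])

/-- `S` is a Gaussian sketch: its entries are i.i.d. normal with mean `0` and variance `1 / m`. -/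
structure IsGaussianSketch {Ω : Type*} [MeasurableSpace Ω] {m N : ℕ}
    (S : Ω → Matrix (Fin m) (Fin N) ℝ) (P : Measure Ω) : Prop where
  indep : iIndepFun (fun (p : Fin m × Fin N) (ω : Ω) => S ω p.1 p.2) P
  law : ∀ (i : Fin m) (j : Fin N),
    HasLaw (fun ω => S ω i j) (gaussianReal 0 ((m : ℝ≥0)⁻¹)) P

/-- `range(A)` as a subspace of Euclidean space. -/
noncomputable def colSpace {N d : ℕ} (A : Matrix (Fin N) (Fin d) ℝ) :
    Submodule ℝ (EuclideanSpace ℝ (Fin N)) :=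
  LinearMap.range (Matrix.toEuclideanLin A)

/-- The orthogonal projection of `v` onto `range(A)`. -/
noncomputable def projRange {N d : ℕ} (A : Matrix (Fin N) (Fin d) ℝ)
    (v : EuclideanSpace ℝ (Fin N)) : EuclideanSpace ℝ (Fin N) :=
  (colSpace A).starProjection v

/-- The orthogonal projection of `v` onto the orthogonal complement of `range(A)`. -/
noncomputable def projPerp {N d : ℕ} (A : Matrix (Fin N) (Fin d) ℝ)
    (v : EuclideanSpace ℝ (Fin N)) : EuclideanSpace ℝ (Fin N) :=
  (colSpace A)ᗮ.starProjection v

/-- The vector `v ≠ 0` rescaled to unit length. -/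
noncomputable def unitVec {N : ℕ} (v : EuclideanSpace ℝ (Fin N)) : EuclideanSpace ℝ (Fin N) :=
  ‖v‖⁻¹ • v

/-- `φ`, the absolute correlation of two vectors. -/
noncomputable def absCorr {N : ℕ} (b b' : EuclideanSpace ℝ (Fin N)) : ℝ :=
  |inner ℝ b b'| / (‖b‖ * ‖b'‖)

/-- `κ`, the relative energy of `b` in `range(A)`. -/
noncomputable def relEnergy {N d : ℕ} (A : Matrix (Fin N) (Fin d) ℝ)
    (b : EuclideanSpace ℝ (Fin N)) : ℝ :=
  ‖projRange A b‖ / ‖b‖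

end BiFidelity

open scoped ENNReal RealInnerProductSpace Matrix

/-! Let `e` be an orthonormal basis of range(A), with r members, and `u` the unit vector along the
residual of `b`. The rescaled images `G k = √m S e_k` and `g = √m S u` are independent standard
Gaussian vectors in ℝ^m. The normal equations show that A x̂ - P b is, up to the factor ‖P⊥ b‖, the
combination of the `e_k` whose coefficients are those of the projection of `g` onto span `G`. Hence
μ²(b, S) = |G†g|² almost surely (`optimalityCoeff_sq_eq`), and its law does not depend on `b`.

For a second vector write its residual direction as v = ρu + tw with w ⊥ u; then √m S v = ρg + th
with `h` an independent copy of `g`. Expanding |G†(ρg + th)|², the covariance with |G†g|² is ρ²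
Var|G†g|², plus a cross term that is odd in `h` and so vanishes, plus t² Cov(|G†g|², |G†h|²). The
last is nonnegative because the two variables are i.i.d. given `G` (`covariance_projCoeffsSq_ge`).
Since both variances agree, corr ≥ ρ² as soon as second moments exist, which m ≥ r + 8 ensures
(`memLp_projCoeffsSq`). So the probabilistic bound is not asymptotic, and the two stated bounds
follow from elementary inequalities for ρ² (`general_bound_le`, `energy_bound_le`). -/

namespace BiFidelity

/-! ### Standard Gaussian measures and a negative moment -/

section Gaussian

variable {E F : Type*} [NormedAddCommGroup E] [InnerProductSpace ℝ E] [FiniteDimensional ℝ E]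
  [MeasurableSpace E] [BorelSpace E] [NormedAddCommGroup F] [InnerProductSpace ℝ F]
  [FiniteDimensional ℝ F] [MeasurableSpace F] [BorelSpace F]

/-- A linear map whose adjoint is isometric transports the standard Gaussian measure to the
standard Gaussian measure. -/
theorem measurePreserving_of_adjoint_isometry (f : E →ₗ[ℝ] F) (f' : F → E)
    (hadj : ∀ x t, ⟪f x, t⟫ = ⟪x, f' t⟫) (hnorm : ∀ t, ‖f' t‖ = ‖t‖) :
    MeasurePreserving f (stdGaussian E) (stdGaussian F) := by
  have hf : Continuous f := f.continuous_of_finiteDimensional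
  refine ⟨hf.measurable, ?_⟩
  have : IsProbabilityMeasure ((stdGaussian E).map f) :=
    Measure.isProbabilityMeasure_map hf.aemeasurable
  apply Measure.ext_of_charFun
  ext t
  rw [charFun_stdGaussian, charFun_apply, integral_map hf.aemeasurable (by fun_prop)]
  simp_rw [hadj]
  rw [← charFun_apply, charFun_stdGaussian, hnorm]

theorem map_pi_stdGaussian (ι : Type*) [Fintype ι] :
    (Measure.pi fun _ : ι => stdGaussian E).map (WithLp.toLp 2) =
      stdGaussian (PiLp 2 fun _ : ι => E) := by
  have : IsProbabilityMeasure ((Measure.pi fun _ : ι => stdGaussian E).map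
      (WithLp.toLp 2)) := Measure.isProbabilityMeasure_map (by fun_prop)
  apply Measure.ext_of_charFun (E := PiLp 2 fun _ : ι => E)
  ext t
  simp_rw [charFun_stdGaussian, charFun_pi, charFun_stdGaussian, ← Complex.exp_sum,
    ← Complex.ofReal_pow, PiLp.norm_sq_eq_of_L2]
  simp [Finset.sum_div, neg_div]

/-- The coordinates of a standard Gaussian vector along an orthonormal family are independent
standard normal variables. -/
theorem measurePreserving_inner_orthonormal {ι : Type*} [Fintype ι] {f : ι → E}
    (hf : Orthonormal ℝ f) :
    MeasurePreserving (fun (x : E) k => ⟪f k, x⟫) (stdGaussian E)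
      (Measure.pi fun _ : ι => gaussianReal 0 1) := by
  refine ⟨by fun_prop, ?_⟩
  let L : E →ₗ[ℝ] EuclideanSpace ℝ ι :=
    (WithLp.linearEquiv 2 ℝ (ι → ℝ)).symm.toLinearMap ∘ₗ
      LinearMap.pi fun k => (innerSL ℝ (f k)).toLinearMap
  have hL : MeasurePreserving L (stdGaussian E) (stdGaussian (EuclideanSpace ℝ ι)) := by
    refine measurePreserving_of_adjoint_isometry L (fun t => ∑ k, t k • f k) ?_ ?_
    · intro x t
      simp [L, PiLp.inner_apply, inner_sum, inner_smul_right, real_inner_comm]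
    · intro t
      rw [← sq_eq_sq₀ (norm_nonneg _) (norm_nonneg _), ← real_inner_self_eq_norm_sq,
        hf.inner_sum, EuclideanSpace.real_norm_sq_eq]
      simp [sq]
  have h2 := congrArg (Measure.map (WithLp.ofLp : EuclideanSpace ℝ ι → ι → ℝ))
    (hL.map_eq.trans map_pi_eq_stdGaussian.symm)
  rw [Measure.map_map (by fun_prop) hL.measurable,
    Measure.map_map (by fun_prop) (by fun_prop)] at h2
  exact h2.trans Measure.map_id

/-- Full support upgrades almost sure equality of continuous functions to equality everywhere; the
positivity of the variance rests on this. -/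
instance : (stdGaussian E).IsOpenPosMeasure := by
  rw [stdGaussian_eq_map_pi_orthonormalBasis (stdOrthonormalBasis ℝ E)]
  have : (gaussianReal 0 1).IsOpenPosMeasure :=
    (gaussianReal_absolutelyContinuous' 0 one_ne_zero).isOpenPosMeasure
  refine Continuous.isOpenPosMeasure_map (by fun_prop) fun y => ?_
  exact ⟨fun i => (stdOrthonormalBasis ℝ E).repr y i, (stdOrthonormalBasis ℝ E).sum_repr y⟩

theorem measurePreserving_neg_stdGaussian :
    MeasurePreserving (fun x : E => -x) (stdGaussian E) (stdGaussian E) := by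
  refine ⟨by fun_prop, ?_⟩
  exact stdGaussian_map (LinearIsometryEquiv.neg ℝ)

/-- A bound c / |z| has no fourth moment from a single z. Spread over eight independent directions,
each carries only the exponent -4/8 = -1/2, which is integrable at the origin. -/
theorem integrable_abs_rpow_neg_half_gaussianReal :
    Integrable (fun z : ℝ => |z| ^ (-(1 / 2) : ℝ)) (gaussianReal 0 1) := by
  have hpos : IntegrableOn (fun x : ℝ => |x| ^ (-(1 / 2) : ℝ) * Real.exp (-(1 / 2) * |x| ^ 2))
      (Set.Ioi 0) :=
    (integrableOn_rpow_mul_exp_neg_mul_sq (b := 1 / 2) (s := -(1 / 2)) (by norm_num)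
      (by norm_num)).congr_fun (fun x hx => by simp [abs_of_pos (Set.mem_Ioi.mp hx)])
      measurableSet_Ioi
  have hneg : IntegrableOn (fun x : ℝ => |x| ^ (-(1 / 2) : ℝ) * Real.exp (-(1 / 2) * |x| ^ 2))
      (Set.Iic 0) := by
    rw [← Measure.map_neg_eq_self (volume : Measure ℝ)]
    have m : MeasurableEmbedding fun x : ℝ => -x := (Homeomorph.neg ℝ).measurableEmbedding
    rw [m.integrableOn_map_iff]
    simp_rw [Function.comp_def, abs_neg, Set.neg_preimage, Set.neg_Iic, neg_zero]
    exact Iff.mpr integrableOn_Ici_iff_integrableOn_Ioi hpos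
  have hall := hneg.union hpos
  rw [Set.Iic_union_Ioi, integrableOn_univ] at hall
  rw [gaussianReal_of_var_ne_zero 0 one_ne_zero, integrable_withDensity_iff_integrable_smul'
    (measurable_gaussianPDF 0 1) (ae_of_all _ fun _ => gaussianPDF_lt_top)]
  refine (hall.const_mul (Real.sqrt (2 * Real.pi))⁻¹).congr (ae_of_all _ fun x => ?_)
  simp only [toReal_gaussianPDF, gaussianPDFReal, smul_eq_mul, sq_abs]
  simp only [NNReal.coe_one, mul_one, sub_zero]
  rw [show -x ^ 2 / 2 = -(1 / 2) * x ^ 2 by ring]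
  ring

/-- The expectation of `∏ k, |z k| ^ (-1/2)` for eight independent standard normal variables. -/
noncomputable def gaussianNegMoment : ℝ≥0∞ :=
  ∫⁻ z : Fin 8 → ℝ, ENNReal.ofReal (∏ k, |z k| ^ (-(1 / 2) : ℝ))
    ∂(Measure.pi fun _ => gaussianReal 0 1)

theorem gaussianNegMoment_ne_top : gaussianNegMoment ≠ ∞ :=
  (Integrable.fintype_prod
    fun _ => integrable_abs_rpow_neg_half_gaussianReal).lintegral_lt_top.ne

/-- A function that is bounded by `c / |⟪f k, x⟫|` for eight orthonormal directions `f k` has a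
fourth moment, bounded by an absolute constant times `c ^ 4`. -/
theorem lintegral_pow_four_le {f : Fin 8 → E} (hf : Orthonormal ℝ f) {φ : E → ℝ} {c : ℝ}
    (hφ : ∀ x k, |φ x| * |⟪f k, x⟫| ≤ c) :
    ∫⁻ x, ENNReal.ofReal (φ x ^ 4) ∂(stdGaussian E) ≤
      ENNReal.ofReal (c ^ 4) * gaussianNegMoment := by
  have hmp := measurePreserving_inner_orthonormal hf
  -- At `z k = 0` the real power takes the value 0 and the majorant would fail, so this null set is
  -- removed.
  have hne : ∀ᵐ z ∂(Measure.pi fun _ : Fin 8 => gaussianReal 0 1), ∀ k, z k ≠ 0 := by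
    rw [ae_all_iff]
    intro k
    have : NullSingletonClass (gaussianReal 0 1) := nullSingletonClass_gaussianReal one_ne_zero
    exact (measurePreserving_eval _ k).quasiMeasurePreserving.ae (Measure.ae_ne _ 0)
  have hne' := hmp.quasiMeasurePreserving.ae hne
  have hm : Measurable fun z : Fin 8 → ℝ => ENNReal.ofReal (∏ k, |z k| ^ (-(1 / 2) : ℝ)) := by
    fun_prop
  rw [gaussianNegMoment, ← hmp.lintegral_comp hm,
    ← lintegral_const_mul _ (by fun_prop)]
  refine lintegral_mono_ae ?_
  filter_upwards [hne'] with x hx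
  have hc : 0 ≤ c := le_trans (by positivity) (hφ x 0)
  rw [← ENNReal.ofReal_mul (by positivity)]
  refine ENNReal.ofReal_le_ofReal ?_
  -- The fourth power is split into eight square roots, one for each of the eight available bounds.
  have h4 : ∀ a : ℝ, 0 ≤ a → a ^ 4 = ∏ _k : Fin 8, a ^ (1 / 2 : ℝ) := by
    intro a ha
    rw [Finset.prod_const, Finset.card_univ, Fintype.card_fin, ← Real.rpow_mul_natCast ha,
      ← Real.rpow_natCast]
    norm_num
  rw [← Even.pow_abs (by decide), h4 _ (abs_nonneg _), h4 _ hc, ← Finset.prod_mul_distrib]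
  refine Finset.prod_le_prod (fun k _ => by positivity) fun k _ => ?_
  have hk : 0 < |⟪f k, x⟫| := abs_pos.mpr (hx k)
  rw [Real.rpow_neg hk.le, ← div_eq_mul_inv, ← Real.div_rpow hc hk.le]
  exact Real.rpow_le_rpow (abs_nonneg _) ((le_div_iff₀ hk).mpr (hφ x k)) (by norm_num)

end Gaussian

/-! ### Coefficients of a projection with respect to a family of vectors -/

section Coefficients

variable {E ι : Type*} [NormedAddCommGroup E] [InnerProductSpace ℝ E]

theorem continuous_gram : Continuous fun G : ι → E => Matrix.gram ℝ G := by
  refine continuous_matrix fun i j => ?_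
  simp only [Matrix.gram_apply]
  fun_prop

variable [Fintype ι]

theorem gram_mulVec_apply (G : ι → E) (y : ι → ℝ) (j : ι) :
    (Matrix.gram ℝ G *ᵥ y) j = ⟪G j, ∑ k, y k • G k⟫ := by
  simp [Matrix.mulVec, dotProduct, Matrix.gram_apply, inner_sum, inner_smul_right, mul_comm]

variable [DecidableEq ι]

/-- The coefficients of the orthogonal projection of `g` onto the span of a linearly independent
family `G`, in terms of that family. -/
noncomputable def projCoeffs (G : ι → E) (g : E) : ι → ℝ :=
  (Matrix.gram ℝ G)⁻¹ *ᵥ fun j => ⟪G j, g⟫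

/-- The squared Euclidean norm of the vector of projection coefficients. -/
noncomputable def projCoeffsSq (G : ι → E) (g : E) : ℝ :=
  projCoeffs G g ⬝ᵥ projCoeffs G g

theorem eq_projCoeffs {G : ι → E} (hG : LinearIndependent ℝ G) {g : E} {y : ι → ℝ}
    (h : ∀ j, ⟪G j, ∑ k, y k • G k⟫ = ⟪G j, g⟫) : y = projCoeffs G g := by
  have hdet : IsUnit (Matrix.gram ℝ G).det :=
    (Matrix.det_gram_ne_zero_iff_linearIndependent.mpr hG).isUnit
  have : Matrix.gram ℝ G *ᵥ y = fun j => ⟪G j, g⟫ := by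
    ext j
    rw [gram_mulVec_apply, h]
  rw [projCoeffs, ← this, Matrix.mulVec_mulVec, Matrix.nonsing_inv_mul _ hdet, Matrix.one_mulVec]

theorem inner_sum_projCoeffs {G : ι → E} (hG : LinearIndependent ℝ G) (g : E) (j : ι) :
    ⟪G j, ∑ k, projCoeffs G g k • G k⟫ = ⟪G j, g⟫ := by
  have hdet : IsUnit (Matrix.gram ℝ G).det :=
    (Matrix.det_gram_ne_zero_iff_linearIndependent.mpr hG).isUnit
  rw [← gram_mulVec_apply, projCoeffs, Matrix.mulVec_mulVec, Matrix.mul_nonsing_inv _ hdet,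
    Matrix.one_mulVec]

/-- The inverse of a singular matrix is 0 by convention, so upper bounds on the coefficients hold
for dependent families too. -/
theorem projCoeffs_of_not_linearIndependent {G : ι → E} (hG : ¬ LinearIndependent ℝ G) (g : E) :
    projCoeffs G g = 0 := by
  have hdet : ¬ IsUnit (Matrix.gram ℝ G).det := by
    rwa [isUnit_iff_ne_zero, Matrix.det_gram_ne_zero_iff_linearIndependent]
  rw [projCoeffs, Matrix.nonsing_inv_apply_not_isUnit _ hdet, Matrix.zero_mulVec]

theorem projCoeffs_add (G : ι → E) (g h : E) :
    projCoeffs G (g + h) = projCoeffs G g + projCoeffs G h := by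
  simp only [projCoeffs, inner_add_right, ← Matrix.mulVec_add]
  rfl

theorem projCoeffs_smul (G : ι → E) (c : ℝ) (g : E) :
    projCoeffs G (c • g) = c • projCoeffs G g := by
  simp only [projCoeffs, inner_smul_right, ← Matrix.mulVec_smul]
  rfl

theorem projCoeffs_neg (G : ι → E) (g : E) : projCoeffs G (-g) = -projCoeffs G g := by
  simpa using projCoeffs_smul G (-1) g

theorem projCoeffsSq_smul (G : ι → E) (c : ℝ) (g : E) :
    projCoeffsSq G (c • g) = c ^ 2 * projCoeffsSq G g := by
  simp only [projCoeffsSq, projCoeffs_smul, smul_dotProduct, dotProduct_smul, smul_eq_mul]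
  ring

theorem projCoeffsSq_nonneg (G : ι → E) (g : E) : 0 ≤ projCoeffsSq G g :=
  Finset.sum_nonneg fun _ _ => mul_self_nonneg _

theorem projCoeffsSq_self {G : ι → E} (hG : LinearIndependent ℝ G) (j : ι) :
    projCoeffsSq G (G j) = 1 := by
  have : Pi.single j 1 = projCoeffs G (G j) := eq_projCoeffs hG fun i => by
    simp [Pi.single_apply]
  simp [projCoeffsSq, ← this]

theorem projCoeffsSq_linear_comb (G : ι → E) (g h : E) (s t : ℝ) :
    projCoeffsSq G (s • g + t • h) = s ^ 2 * projCoeffsSq G g +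
      (2 * s * t * (projCoeffs G g ⬝ᵥ projCoeffs G h) + t ^ 2 * projCoeffsSq G h) := by
  simp only [projCoeffsSq, projCoeffs_smul, projCoeffs_add, smul_dotProduct, dotProduct_smul,
    smul_eq_mul, add_dotProduct, dotProduct_add,
    dotProduct_comm (projCoeffs G h) (projCoeffs G g)]
  ring

/-- Both |c + c'|² and |c - c'|² are nonnegative. This gives the cross term the integrability of the
squares. -/
theorem abs_projCoeffs_dotProduct_le (G : ι → E) (g h : E) :
    |projCoeffs G g ⬝ᵥ projCoeffs G h| ≤ projCoeffsSq G g + projCoeffsSq G h := by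
  have h1 := projCoeffsSq_linear_comb G g h 1 1
  have h2 := projCoeffsSq_linear_comb G g h 1 (-1)
  have h3 := projCoeffsSq_nonneg G ((1 : ℝ) • g + (1 : ℝ) • h)
  have h4 := projCoeffsSq_nonneg G ((1 : ℝ) • g + (-1 : ℝ) • h)
  have h5 := projCoeffsSq_nonneg G g
  have h6 := projCoeffsSq_nonneg G h
  rw [abs_le]
  constructor <;> nlinarith

/-- The `j`-th coefficient is controlled by the part of `G j` that is orthogonal to the other
members of the family. -/
theorem abs_projCoeffs_mul_inner_le (G : ι → E) (g : E) (j : ι) {p : E} (hp : ‖p‖ = 1)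
    (hpG : ∀ k, k ≠ j → ⟪p, G k⟫ = 0) : |projCoeffs G g j| * |⟪p, G j⟫| ≤ ‖g‖ := by
  by_cases hG : LinearIndependent ℝ G
  -- `q` is the projection of `g` onto the span, so it is no longer than `g`; pairing it with `p`
  -- isolates the `j`-th coefficient.
  · set q := ∑ k, projCoeffs G g k • G k with hq
    have h1 : ⟪p, q⟫ = projCoeffs G g j * ⟪p, G j⟫ := by
      rw [hq, inner_sum, Finset.sum_eq_single j]
      · rw [inner_smul_right]
      · intro k _ hk
        rw [inner_smul_right, hpG k hk, mul_zero]
      · simp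
    have h2 : ⟪q, q⟫ = ⟪q, g⟫ := by
      nth_rewrite 1 3 [hq]
      simp only [sum_inner, inner_smul_left]
      refine Finset.sum_congr rfl fun k _ => ?_
      rw [inner_sum_projCoeffs hG]
    have h3 : ‖q‖ ≤ ‖g‖ := by
      rcases (norm_nonneg q).eq_or_lt with h0 | h0
      · rw [← h0]
        exact norm_nonneg g
      · have := real_inner_le_norm q g
        rw [← h2, real_inner_self_eq_norm_mul_norm] at this
        exact le_of_mul_le_mul_left this h0
    rw [← abs_mul, ← h1]
    calc |⟪p, q⟫| ≤ ‖p‖ * ‖q‖ := abs_real_inner_le_norm p q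
      _ ≤ ‖g‖ := by rwa [hp, one_mul]
  · simp [projCoeffs_of_not_linearIndependent hG]

theorem continuous_projCoeffs (G : ι → E) : Continuous (projCoeffs G) := by
  unfold projCoeffs
  fun_prop

theorem continuous_projCoeffsSq (G : ι → E) : Continuous (projCoeffsSq G) := by
  have := continuous_projCoeffs G
  unfold projCoeffsSq
  fun_prop

variable [MeasurableSpace E] [BorelSpace E] [FiniteDimensional ℝ E]

/-- Joint continuity can fail where the Gram matrix degenerates. Writing the inverse as adjugate
over determinant leaves only continuous functions and a scalar inversion. -/
theorem measurable_projCoeffs (j : ι) :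
    Measurable fun x : (ι → E) × E => projCoeffs x.1 x.2 j := by
  have hgram := continuous_gram (E := E) (ι := ι)
  have hadj : ∀ k, Measurable fun x : (ι → E) × E => (Matrix.gram ℝ x.1).adjugate j k := fun k =>
    (((hgram.matrix_adjugate).comp continuous_fst).matrix_elem j k).measurable
  have hdet : Measurable fun x : (ι → E) × E => (Matrix.gram ℝ x.1).det :=
    ((hgram.matrix_det).comp continuous_fst).measurable
  have hin : ∀ k, Measurable fun x : (ι → E) × E => ⟪x.1 k, x.2⟫ := fun k => by fun_prop
  simp only [projCoeffs, Matrix.inv_def, Matrix.mulVec, dotProduct, Matrix.smul_apply,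
    Ring.inverse_eq_inv', smul_eq_mul]
  exact Finset.measurable_sum _ fun k _ => (hdet.inv.mul (hadj k)).mul (hin k)

theorem _root_.Measurable.projCoeffs {α : Type*} [MeasurableSpace α] {G : α → ι → E} {g : α → E}
    (hG : Measurable G) (hg : Measurable g) (j : ι) :
    Measurable fun a => projCoeffs (G a) (g a) j := by
  have h := (measurable_projCoeffs (E := E) j).comp (hG.prodMk hg)
  simpa only [Function.comp_def] using h

theorem _root_.Measurable.projCoeffsSq {α : Type*} [MeasurableSpace α] {G : α → ι → E} {g : α → E}
    (hG : Measurable G) (hg : Measurable g) : Measurable fun a => projCoeffsSq (G a) (g a) := by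
  simp only [BiFidelity.projCoeffsSq, dotProduct]
  exact Finset.measurable_sum _ fun j _ => (hG.projCoeffs hg j).mul (hG.projCoeffs hg j)

theorem measurableSet_linearIndependent :
    MeasurableSet {G : ι → E | LinearIndependent ℝ G} := by
  have hdet : Measurable fun G : ι → E => (Matrix.gram ℝ G).det :=
    (continuous_gram (E := E) (ι := ι)).matrix_det.measurable
  simp_rw [← Matrix.det_gram_ne_zero_iff_linearIndependent]
  exact hdet (measurableSet_singleton 0).compl

end Coefficients

/-- Integrating the `j`-th coordinate first gives a bound uniform in the others, which survives
averaging under a probability measure. -/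
theorem lintegral_pi_le_of_forall_update {ι X : Type*} [Fintype ι] [DecidableEq ι]
    [MeasurableSpace X] {μ : Measure X} [IsProbabilityMeasure μ] {f : (ι → X) → ℝ≥0∞}
    (hf : Measurable f) (j : ι) {c : ℝ≥0∞}
    (h : ∀ G, ∫⁻ x, f (Function.update G j x) ∂μ ≤ c) :
    ∫⁻ G, f G ∂(Measure.pi fun _ : ι => μ) ≤ c := by
  have := lintegral_le_of_lmarginal_le (μ := fun _ : ι => μ) {j} hf
    (measurable_const (a := c)) fun G => by
      rw [lmarginal_singleton, lmarginal_singleton, lintegral_const, measure_univ, mul_one]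
      exact h G
  rwa [lintegral_const, measure_univ, mul_one] at this

/-! ### Second moment and positive variance of the model variable -/

section Moments

variable {E : Type*} [NormedAddCommGroup E] [InnerProductSpace ℝ E] [FiniteDimensional ℝ E]

theorem exists_orthonormal_fin_of_le_finrank (V : Submodule ℝ E) {n : ℕ}
    (hn : n ≤ Module.finrank ℝ V) : ∃ f : Fin n → E, Orthonormal ℝ f ∧ ∀ k, f k ∈ V := by
  refine ⟨fun k => (stdOrthonormalBasis ℝ V (Fin.castLE hn k) : E), ?_, fun k => Subtype.prop _⟩
  have h := (stdOrthonormalBasis ℝ V).orthonormal.comp (Fin.castLE hn)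
    (Fin.castLE_injective hn)
  exact h.comp_linearIsometry V.subtypeₗᵢ

variable [MeasurableSpace E] [BorelSpace E]

/-- The coordinate along a unit vector orthogonal to `V` is standard normal, hence almost surely
nonzero. -/
theorem stdGaussian_submodule_eq_zero {V : Submodule ℝ E}
    (hV : Module.finrank ℝ V < Module.finrank ℝ E) : ∀ᵐ x ∂(stdGaussian E), x ∉ V := by
  have hfin := V.finrank_add_finrank_orthogonal
  obtain ⟨f, hf, hfV⟩ := exists_orthonormal_fin_of_le_finrank Vᗮ (n := 1) (by omega)
  have : NullSingletonClass (gaussianReal 0 1) := nullSingletonClass_gaussianReal one_ne_zero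
  have h1 := (measurePreserving_eval (fun _ : Fin 1 => gaussianReal 0 1) 0).comp
    (measurePreserving_inner_orthonormal hf)
  filter_upwards [h1.quasiMeasurePreserving.ae (Measure.ae_ne _ 0)] with x hx hxV
  exact hx (Submodule.inner_left_of_mem_orthogonal hxV (hfV 0))

/-- Vectors are added one at a time: each new one almost surely avoids the span of the others, a
proper subspace. -/
theorem ae_linearIndependent {r : ℕ} (hr : r ≤ Module.finrank ℝ E) :
    ∀ᵐ G ∂(Measure.pi fun _ : Fin r => stdGaussian E), LinearIndependent ℝ G := by
  induction r with
  | zero => exact ae_of_all _ fun G => linearIndependent_empty_type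
  | succ n ih =>
    have hmp := measurePreserving_piFinSuccAbove (fun _ : Fin (n + 1) => stdGaussian E) 0
    have hset := measurableSet_linearIndependent (E := E) (ι := Fin (n + 1))
    have hswap := (Measure.measurePreserving_swap (μ := Measure.pi fun _ : Fin n => stdGaussian E)
      (ν := stdGaussian E))
    have hcomp := (hmp.symm _).comp hswap
    rw [← hcomp.map_eq, ae_map_iff hcomp.aemeasurable hset]
    refine (Measure.ae_prod_iff_ae_ae (hcomp.measurable hset)).mpr ?_
    filter_upwards [ih (by omega)] with T hT
    have hrank : Module.finrank ℝ (Submodule.span ℝ (Set.range T)) < Module.finrank ℝ E := by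
      rw [finrank_span_eq_card hT, Fintype.card_fin]
      omega
    filter_upwards [stdGaussian_submodule_eq_zero hrank] with x hx
    have hcons : (MeasurableEquiv.piFinSuccAbove (fun _ : Fin (n + 1) => E) 0).symm (x, T) =
        Fin.cons x T := Fin.insertNth_zero' x T
    change LinearIndependent ℝ
      ((MeasurableEquiv.piFinSuccAbove (fun _ : Fin (n + 1) => E) 0).symm (x, T))
    rw [hcons]
    exact linearIndependent_finCons.mpr ⟨hT, hx⟩

theorem lintegral_norm_pow_four_lt_top :
    ∫⁻ g, ENNReal.ofReal (‖g‖ ^ 4) ∂(stdGaussian E) < ∞ := by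
  have h := (IsGaussian.memLp_id (stdGaussian E) 4 (by norm_num)).integrable_norm_pow (p := 4)
    (by norm_num)
  exact h.lintegral_lt_top

theorem lintegral_update_projCoeffs_pow_four_le {r : ℕ} (hr : r + 8 ≤ Module.finrank ℝ E)
    (j : Fin r) (g : E) (G : Fin r → E) :
    ∫⁻ x, ENNReal.ofReal (projCoeffs (Function.update G j x) g j ^ 4) ∂(stdGaussian E) ≤
      ENNReal.ofReal (‖g‖ ^ 4) * gaussianNegMoment := by
  set V := Submodule.span ℝ (Set.range fun k : {k // k ≠ j} => G k) with hV
  have hVr : Module.finrank ℝ V ≤ r := by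
    refine (finrank_range_le_card _).trans ?_
    simp
  have hfin := V.finrank_add_finrank_orthogonal
  -- The hypothesis `r + 8 ≤ finrank` leaves at least eight dimensions orthogonal to the other
  -- members of the family; each yields a bound ‖g‖ / |⟪f k, x⟫| on the `j`-th coefficient.
  obtain ⟨f, hf, hfV⟩ := exists_orthonormal_fin_of_le_finrank Vᗮ (n := 8) (by omega)
  refine lintegral_pow_four_le hf fun x k => ?_
  have := abs_projCoeffs_mul_inner_le (Function.update G j x) g j (hf.1 k) fun i hi => by
    rw [Function.update_of_ne hi]
    exact Submodule.inner_left_of_mem_orthogonal 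
      (Submodule.subset_span (Set.mem_range_self (⟨i, hi⟩ : {k // k ≠ j}))) (hfV k)
  simpa using this

theorem lintegral_projCoeffs_pow_four_lt_top {r : ℕ} (hr : r + 8 ≤ Module.finrank ℝ E)
    (j : Fin r) :
    ∫⁻ x, ENNReal.ofReal (projCoeffs x.1 x.2 j ^ 4)
      ∂((Measure.pi fun _ : Fin r => stdGaussian E).prod (stdGaussian E)) < ∞ := by
  have hm : Measurable fun x : (Fin r → E) × E => ENNReal.ofReal (projCoeffs x.1 x.2 j ^ 4) :=
    ((measurable_projCoeffs j).pow_const 4).ennreal_ofReal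
  rw [lintegral_prod_symm _ hm.aemeasurable]
  have hle : ∀ g : E, ∫⁻ G, ENNReal.ofReal (projCoeffs G g j ^ 4)
      ∂(Measure.pi fun _ : Fin r => stdGaussian E) ≤
      ENNReal.ofReal (‖g‖ ^ 4) * gaussianNegMoment := by
    intro g
    have hmg : Measurable fun G : Fin r → E => ENNReal.ofReal (projCoeffs G g j ^ 4) :=
      ((measurable_id.projCoeffs measurable_const j).pow_const 4).ennreal_ofReal
    exact lintegral_pi_le_of_forall_update hmg j
      (lintegral_update_projCoeffs_pow_four_le hr j g)
  refine (lintegral_mono hle).trans_lt ?_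
  rw [lintegral_mul_const _ (by fun_prop)]
  exact ENNReal.mul_lt_top lintegral_norm_pow_four_lt_top gaussianNegMoment_ne_top.lt_top

theorem memLp_projCoeffsSq {r : ℕ} (hr : r + 8 ≤ Module.finrank ℝ E) :
    MemLp (fun x : (Fin r → E) × E => projCoeffsSq x.1 x.2) 2
      ((Measure.pi fun _ : Fin r => stdGaussian E).prod (stdGaussian E)) := by
  refine memLp_finsetSum (f := fun j (x : (Fin r → E) × E) =>
    projCoeffs x.1 x.2 j * projCoeffs x.1 x.2 j) Finset.univ fun j _ => ?_
  have hm : Measurable fun x : (Fin r → E) × E => projCoeffs x.1 x.2 j * projCoeffs x.1 x.2 j :=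
    (measurable_projCoeffs j).mul (measurable_projCoeffs j)
  rw [memLp_two_iff_integrable_sq hm.aestronglyMeasurable]
  refine ⟨(hm.pow_const 2).aestronglyMeasurable, ?_⟩
  rw [hasFiniteIntegral_iff_ofReal (ae_of_all _ fun x => sq_nonneg _)]
  refine lt_of_eq_of_lt ?_ (lintegral_projCoeffs_pow_four_lt_top hr j)
  congr! 3
  ring

/-- With zero variance, for almost every `G` the continuous function `projCoeffsSq G` would be
constant almost everywhere, hence everywhere. But it is 0 at the origin and 1 at a member of an
independent `G`. -/
theorem variance_projCoeffsSq_pos {r : ℕ} (hr0 : 0 < r) (hr : r + 8 ≤ Module.finrank ℝ E) :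
    0 < Var[fun x : (Fin r → E) × E => projCoeffsSq x.1 x.2;
      (Measure.pi fun _ : Fin r => stdGaussian E).prod (stdGaussian E)] := by
  refine (variance_nonneg _ _).lt_of_ne' fun h0 => ?_
  have h1 := ae_eq_integral_of_variance_eq_zero (memLp_projCoeffsSq hr) h0
  have h2 := Measure.ae_ae_of_ae_prod h1
  obtain ⟨G, hG, hGc⟩ := ((ae_linearIndependent (E := E) (r := r) (by omega)).and h2).exists
  have h3 := (Continuous.ae_eq_iff_eq _ (continuous_projCoeffsSq G) continuous_const).mp hGc
  have h4 := congrFun h3 (G ⟨0, hr0⟩)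
  rw [← congrFun h3 0, projCoeffsSq_self hG] at h4
  have h5 := projCoeffsSq_smul G 0 0
  simp only [zero_smul] at h5
  rw [h5] at h4
  norm_num at h4

end Moments

/-! ### Covariance inequality for the model -/

section Covariance

/-- Two conditionally i.i.d. variables are nonnegatively correlated. -/
theorem covariance_prod_nonneg {α β : Type*} [MeasurableSpace α] [MeasurableSpace β]
    {μ : Measure α} {ν : Measure β} [IsProbabilityMeasure μ] [IsProbabilityMeasure ν]
    {F : α × β → ℝ} (hF : MemLp F 2 (μ.prod ν)) :
    0 ≤ cov[fun x : α × β × β => F (x.1, x.2.1), fun x : α × β × β => F (x.1, x.2.2);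
      μ.prod (ν.prod ν)] := by
  have hp1 : MeasurePreserving (fun x : α × β × β => (x.1, x.2.1)) (μ.prod (ν.prod ν))
      (μ.prod ν) := (MeasurePreserving.id μ).prod measurePreserving_fst
  have hp2 : MeasurePreserving (fun x : α × β × β => (x.1, x.2.2)) (μ.prod (ν.prod ν))
      (μ.prod ν) := (MeasurePreserving.id μ).prod measurePreserving_snd
  have h1 : MemLp (fun x : α × β × β => F (x.1, x.2.1)) 2 (μ.prod (ν.prod ν)) :=
    hF.comp_measurePreserving hp1
  have h2 : MemLp (fun x : α × β × β => F (x.1, x.2.2)) 2 (μ.prod (ν.prod ν)) :=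
    hF.comp_measurePreserving hp2
  have hint : Integrable (fun x : α × β × β => F (x.1, x.2.1) * F (x.1, x.2.2))
      (μ.prod (ν.prod ν)) := h1.integrable_mul h2
  have hFi := hF.integrable one_le_two
  -- With M(a) = ∫ F(a, b) dν(b), both means are ∫ M and the mixed moment is ∫ M², so the covariance
  -- is the variance of M.
  have e1 : ∫ x, F (x.1, x.2.1) ∂(μ.prod (ν.prod ν)) = ∫ a, ∫ b, F (a, b) ∂ν ∂μ := by
    rw [integral_prod _ (h1.integrable one_le_two)]
    congr 1 with a
    rw [integral_fun_fst (fun b => F (a, b))]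
    simp
  have e2 : ∫ x, F (x.1, x.2.2) ∂(μ.prod (ν.prod ν)) = ∫ a, ∫ b, F (a, b) ∂ν ∂μ := by
    rw [integral_prod _ (h2.integrable one_le_two)]
    congr 1 with a
    rw [integral_fun_snd (fun b => F (a, b))]
    simp
  have e3 : ∫ x, F (x.1, x.2.1) * F (x.1, x.2.2) ∂(μ.prod (ν.prod ν)) =
      ∫ a, (∫ b, F (a, b) ∂ν) ^ 2 ∂μ := by
    rw [integral_prod _ hint]
    congr 1 with a
    rw [integral_prod_mul (fun b => F (a, b)) (fun b => F (a, b)), sq]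
  have hsq : Integrable (fun a => (∫ b, F (a, b) ∂ν) ^ 2) μ := by
    refine hint.integral_prod_left.congr (ae_of_all _ fun a => ?_)
    dsimp only
    rw [integral_prod_mul (fun b => F (a, b)) (fun b => F (a, b)), sq]
  have hm : MemLp (fun a => ∫ b, F (a, b) ∂ν) 2 μ :=
    (memLp_two_iff_integrable_sq hFi.integral_prod_left.aestronglyMeasurable).mpr hsq
  have hvar := variance_nonneg (fun a => ∫ b, F (a, b) ∂ν) μ
  rw [variance_eq_sub hm] at hvar
  rw [covariance_eq_sub h1 h2, e1, e2]
  simp only [Pi.mul_apply, Pi.pow_apply] at hvar ⊢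
  rw [e3]
  linarith [sq (∫ a, ∫ b, F (a, b) ∂ν ∂μ)]

theorem integral_eq_zero_of_odd {α : Type*} [MeasurableSpace α] {μ : Measure α} {τ : α → α}
    (hτ : MeasurePreserving τ μ μ) {f : α → ℝ} (hf : AEStronglyMeasurable f μ)
    (hodd : ∀ x, f (τ x) = -f x) : ∫ x, f x ∂μ = 0 := by
  have h : ∫ x, f (τ x) ∂μ = ∫ x, f x ∂μ := by
    conv_rhs => rw [← hτ.map_eq]
    rw [integral_map hτ.aemeasurable (by rwa [hτ.map_eq])]
  simp only [hodd, integral_neg] at h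
  linarith

variable {E : Type*} [NormedAddCommGroup E] [InnerProductSpace ℝ E] [FiniteDimensional ℝ E]
  [MeasurableSpace E] [BorelSpace E]

/-- In the expansion of the second square, the cross term `C` is odd under the measure-preserving
flip of the last vector, so `C` and `X * C` both integrate to 0. The remaining term is a covariance
of conditionally i.i.d. variables. -/
theorem covariance_projCoeffsSq_ge {r : ℕ} (hr : r + 8 ≤ Module.finrank ℝ E) (s t : ℝ) :
    s ^ 2 * Var[fun x : (Fin r → E) × E => projCoeffsSq x.1 x.2;
      (Measure.pi fun _ : Fin r => stdGaussian E).prod (stdGaussian E)] ≤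
    cov[fun x : (Fin r → E) × E × E => projCoeffsSq x.1 x.2.1,
      fun x : (Fin r → E) × E × E => projCoeffsSq x.1 (s • x.2.1 + t • x.2.2);
      (Measure.pi fun _ : Fin r => stdGaussian E).prod
        ((stdGaussian E).prod (stdGaussian E))] := by
  set μ := Measure.pi fun _ : Fin r => stdGaussian E with hμ
  set ν := stdGaussian E with hν
  have hF : MemLp (fun x : (Fin r → E) × E => projCoeffsSq x.1 x.2) 2 (μ.prod ν) :=
    memLp_projCoeffsSq hr
  have hp1 : MeasurePreserving (fun x : (Fin r → E) × E × E => (x.1, x.2.1))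
      (μ.prod (ν.prod ν)) (μ.prod ν) := (MeasurePreserving.id μ).prod measurePreserving_fst
  have hp2 : MeasurePreserving (fun x : (Fin r → E) × E × E => (x.1, x.2.2))
      (μ.prod (ν.prod ν)) (μ.prod ν) := (MeasurePreserving.id μ).prod measurePreserving_snd
  set X := fun x : (Fin r → E) × E × E => projCoeffsSq x.1 x.2.1 with hXdef
  set Z := fun x : (Fin r → E) × E × E => projCoeffsSq x.1 x.2.2 with hZdef
  set C := fun x : (Fin r → E) × E × E => projCoeffs x.1 x.2.1 ⬝ᵥ projCoeffs x.1 x.2.2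
    with hCdef
  have hX : MemLp X 2 (μ.prod (ν.prod ν)) := by
    simpa only [Function.comp_def] using hF.comp_measurePreserving hp1
  have hZ : MemLp Z 2 (μ.prod (ν.prod ν)) := by
    simpa only [Function.comp_def] using hF.comp_measurePreserving hp2
  have hCm : Measurable C := by
    simp only [hCdef, dotProduct]
    exact Finset.measurable_sum _ fun j _ =>
      (measurable_fst.projCoeffs measurable_snd.fst j).mul
        (measurable_fst.projCoeffs measurable_snd.snd j)
  have hC : MemLp C 2 (μ.prod (ν.prod ν)) := by
    refine (hX.add hZ).mono hCm.aestronglyMeasurable (ae_of_all _ fun x => ?_)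
    rw [Real.norm_eq_abs, Real.norm_eq_abs, Pi.add_apply]
    have h := abs_projCoeffs_dotProduct_le x.1 x.2.1 x.2.2
    exact h.trans (le_abs_self (X x + Z x))
  have hflip : MeasurePreserving (fun x : (Fin r → E) × E × E => (x.1, x.2.1, -x.2.2))
      (μ.prod (ν.prod ν)) (μ.prod (ν.prod ν)) :=
    (MeasurePreserving.id μ).prod ((MeasurePreserving.id ν).prod measurePreserving_neg_stdGaussian)
  have hodd : ∀ x : (Fin r → E) × E × E, C (x.1, x.2.1, -x.2.2) = -C x := fun x => by
    simp only [hCdef, projCoeffs_neg, dotProduct_neg]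
  have hC0 : ∫ x, C x ∂(μ.prod (ν.prod ν)) = 0 :=
    integral_eq_zero_of_odd hflip hC.aestronglyMeasurable hodd
  have hXC0 : ∫ x, X x * C x ∂(μ.prod (ν.prod ν)) = 0 := by
    have hXC : ∀ x : (Fin r → E) × E × E,
        X (x.1, x.2.1, -x.2.2) * C (x.1, x.2.1, -x.2.2) = -(X x * C x) := fun x => by
      rw [hodd x, mul_neg]
    exact integral_eq_zero_of_odd hflip (hX.integrable_mul hC).aestronglyMeasurable hXC
  have hcXC : cov[X, C; μ.prod (ν.prod ν)] = 0 := by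
    rw [covariance_eq_sub hX hC, hC0]
    simpa using hXC0
  have hcXZ : 0 ≤ cov[X, Z; μ.prod (ν.prod ν)] := by
    simpa only using covariance_prod_nonneg hF
  have hvar : cov[X, X; μ.prod (ν.prod ν)] =
      Var[fun x : (Fin r → E) × E => projCoeffsSq x.1 x.2; μ.prod ν] := by
    rw [covariance_self hX.aemeasurable]
    simpa only using hp1.variance_fun_comp hF.aemeasurable
  have hY : (fun x : (Fin r → E) × E × E => projCoeffsSq x.1 (s • x.2.1 + t • x.2.2)) =
      (fun x => s ^ 2 * X x) + ((fun x => 2 * s * t * C x) + fun x => t ^ 2 * Z x) := by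
    ext x
    exact projCoeffsSq_linear_comb x.1 x.2.1 x.2.2 s t
  rw [hY, covariance_add_right hX (hX.const_mul _) ((hC.const_mul _).add (hZ.const_mul _)),
    covariance_add_right hX (hC.const_mul _) (hZ.const_mul _), covariance_const_mul_right,
    covariance_const_mul_right, covariance_const_mul_right, hcXC, hvar]
  have := mul_nonneg (sq_nonneg t) hcXZ
  linarith

end Covariance

/-! ### Law of a Gaussian sketch on orthonormal vectors -/

section SketchLaw

theorem hasLaw_ofLp {Ω ι X : Type*} [Fintype ι] [MeasurableSpace Ω] [MeasurableSpace X]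
    {P : Measure Ω} {μ : Measure (ι → X)} {Y : Ω → PiLp 2 fun _ : ι => X}
    (hY : HasLaw Y (μ.map (WithLp.toLp 2)) P) : HasLaw (fun ω => WithLp.ofLp (Y ω)) μ P := by
  have h : HasLaw (WithLp.ofLp : (PiLp 2 fun _ : ι => X) → ι → X) μ (μ.map (WithLp.toLp 2)) := by
    refine ⟨by fun_prop, ?_⟩
    rw [Measure.map_map (by fun_prop) (by fun_prop)]
    exact Measure.map_id
  exact h.fun_comp hY

variable {Ω : Type*} [MeasurableSpace Ω] {P : Measure Ω} {m N : ℕ}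
  {S : Ω → Matrix (Fin m) (Fin N) ℝ}

/-- The rescaled entries of a Gaussian sketch form a standard Gaussian vector. -/
theorem IsGaussianSketch.hasLaw_entries (hS : IsGaussianSketch S P) (hm : 0 < m) :
    HasLaw (fun ω => WithLp.toLp 2 fun p : Fin m × Fin N => Real.sqrt m * S ω p.1 p.2)
      (stdGaussian (EuclideanSpace ℝ (Fin m × Fin N))) P := by
  have hlaw : ∀ p : Fin m × Fin N,
      HasLaw (fun ω => Real.sqrt m * S ω p.1 p.2) (gaussianReal 0 1) P := fun p => by
    have h := gaussianReal_const_mul (hS.law p.1 p.2) (Real.sqrt m)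
    convert h using 2
    · simp
    · ext
      simp [Real.sq_sqrt, hm.ne']
  have hind : iIndepFun (fun (p : Fin m × Fin N) ω => Real.sqrt m * S ω p.1 p.2) P :=
    hS.indep.comp (fun _ x => Real.sqrt m * x) fun _ => by fun_prop
  have hpi : HasLaw (fun ω (p : Fin m × Fin N) => Real.sqrt m * S ω p.1 p.2)
      (Measure.pi fun _ => gaussianReal 0 1) P := hind.hasLaw_pi hlaw
  exact HasLaw.fun_comp ⟨by fun_prop, map_pi_eq_stdGaussian⟩ hpi

/-- The images under a Gaussian sketch of an orthonormal family are independent Gaussian vectors. -/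
theorem IsGaussianSketch.hasLaw_apply_orthonormal (hS : IsGaussianSketch S P) (hm : 0 < m)
    {ι : Type*} [Fintype ι] {e : ι → EuclideanSpace ℝ (Fin N)} (he : Orthonormal ℝ e) :
    HasLaw (fun ω k => Real.sqrt m • Matrix.toEuclideanLin (S ω) (e k))
      (Measure.pi fun _ : ι => stdGaussian (EuclideanSpace ℝ (Fin m))) P := by
  let L : EuclideanSpace ℝ (Fin m × Fin N) →ₗ[ℝ] PiLp 2 fun _ : ι => EuclideanSpace ℝ (Fin m) :=
    { toFun := fun x => WithLp.toLp 2 fun k => WithLp.toLp 2 fun i => ∑ l, x (i, l) * e k l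
      map_add' := fun x y => by
        ext k i
        simp [add_mul, Finset.sum_add_distrib]
      map_smul' := fun c x => by
        ext k i
        simp [mul_assoc, Finset.mul_sum] }
  have hLmap : MeasurePreserving L (stdGaussian (EuclideanSpace ℝ (Fin m × Fin N)))
      (stdGaussian (PiLp 2 fun _ : ι => EuclideanSpace ℝ (Fin m))) := by
    -- The adjoint sends `t` to the matrix ∑ t_k e_kᵀ, an isometry because the `e k` are
    -- orthonormal.
    refine measurePreserving_of_adjoint_isometry L
      (fun t => WithLp.toLp 2 fun p => ∑ k, t k p.1 * e k p.2) ?_ ?_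
    · intro x t
      simp only [L, PiLp.inner_apply, LinearMap.coe_mk, AddHom.coe_mk, Fintype.sum_prod_type]
      simp only [RCLike.inner_apply, conj_trivial, Finset.mul_sum, Finset.sum_mul]
      rw [Finset.sum_comm]
      refine Finset.sum_congr rfl fun i _ => ?_
      rw [Finset.sum_comm]
      refine Finset.sum_congr rfl fun l _ => Finset.sum_congr rfl fun k _ => ?_
      ring
    · intro t
      rw [← sq_eq_sq₀ (norm_nonneg _) (norm_nonneg _), EuclideanSpace.real_norm_sq_eq,
        PiLp.norm_sq_eq_of_L2, Fintype.sum_prod_type]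
      simp_rw [EuclideanSpace.real_norm_sq_eq]
      rw [Finset.sum_comm (γ := ι)]
      refine Finset.sum_congr rfl fun i _ => ?_
      have h : ∀ l, ∑ k, t k i * e k l = (∑ k, t k i • e k) l := fun l => by
        simp
      simp only [h]
      rw [← EuclideanSpace.real_norm_sq_eq, ← real_inner_self_eq_norm_sq, he.inner_sum]
      simp [sq]
  have hL : HasLaw (fun x => WithLp.ofLp (L x))
      (Measure.pi fun _ : ι => stdGaussian (EuclideanSpace ℝ (Fin m)))
      (stdGaussian (EuclideanSpace ℝ (Fin m × Fin N))) := by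
    exact hasLaw_ofLp (by rw [map_pi_stdGaussian]; exact hLmap.hasLaw)
  refine (hL.fun_comp (hS.hasLaw_entries hm)).congr (ae_of_all _ fun ω => ?_)
  ext k i
  simp [L, Matrix.toLpLin_apply, Matrix.mulVec, dotProduct, Finset.mul_sum, mul_assoc]

variable {ι : Type*} [Fintype ι] {e : ι → EuclideanSpace ℝ (Fin N)}
  {u w : EuclideanSpace ℝ (Fin N)}

theorem IsGaussianSketch.hasLaw_pair (hS : IsGaussianSketch S P) (hm : 0 < m)
    (he : Orthonormal ℝ (Sum.elim e fun _ : Unit => u)) :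
    HasLaw (fun ω => (fun k => Real.sqrt m • Matrix.toEuclideanLin (S ω) (e k),
        Real.sqrt m • Matrix.toEuclideanLin (S ω) u))
      ((Measure.pi fun _ : ι => stdGaussian (EuclideanSpace ℝ (Fin m))).prod
        (stdGaussian (EuclideanSpace ℝ (Fin m)))) P := by
  have h1 := measurePreserving_sumPiEquivProdPi
    (fun _ : ι ⊕ Unit => stdGaussian (EuclideanSpace ℝ (Fin m)))
  have h2 := (MeasurePreserving.id
    (Measure.pi fun _ : ι => stdGaussian (EuclideanSpace ℝ (Fin m)))).prod
    (measurePreserving_eval (fun _ : Unit => stdGaussian (EuclideanSpace ℝ (Fin m))) ())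
  exact ((h2.comp h1).hasLaw).fun_comp (hS.hasLaw_apply_orthonormal hm he)

theorem IsGaussianSketch.hasLaw_triple (hS : IsGaussianSketch S P) (hm : 0 < m)
    (he : Orthonormal ℝ (Sum.elim e ![u, w])) :
    HasLaw (fun ω => (fun k => Real.sqrt m • Matrix.toEuclideanLin (S ω) (e k),
        Real.sqrt m • Matrix.toEuclideanLin (S ω) u,
        Real.sqrt m • Matrix.toEuclideanLin (S ω) w))
      ((Measure.pi fun _ : ι => stdGaussian (EuclideanSpace ℝ (Fin m))).prod
        ((stdGaussian (EuclideanSpace ℝ (Fin m))).prod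
          (stdGaussian (EuclideanSpace ℝ (Fin m))))) P := by
  have h1 := measurePreserving_sumPiEquivProdPi
    (fun _ : ι ⊕ Fin 2 => stdGaussian (EuclideanSpace ℝ (Fin m)))
  have h2 := (MeasurePreserving.id
    (Measure.pi fun _ : ι => stdGaussian (EuclideanSpace ℝ (Fin m)))).prod
    (measurePreserving_finTwoArrow (stdGaussian (EuclideanSpace ℝ (Fin m))))
  exact ((h2.comp h1).hasLaw).fun_comp (hS.hasLaw_apply_orthonormal hm he)

end SketchLaw

/-! ### The optimality coefficient through the normal equations -/

section LeastSquares

theorem toEuclideanLin_mul_apply {m N d : ℕ} (S : Matrix (Fin m) (Fin N) ℝ)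
    (A : Matrix (Fin N) (Fin d) ℝ) (x : EuclideanSpace ℝ (Fin d)) :
    Matrix.toEuclideanLin (S * A) x = Matrix.toEuclideanLin S (Matrix.toEuclideanLin A x) := by
  simp [Matrix.toLpLin_apply, Matrix.mulVec_mulVec]

theorem IsLeastSquaresSolution.inner_eq_zero {m d : ℕ} {B : Matrix (Fin m) (Fin d) ℝ}
    {y : EuclideanSpace ℝ (Fin m)} {x : EuclideanSpace ℝ (Fin d)}
    (h : IsLeastSquaresSolution B y x) (z : EuclideanSpace ℝ (Fin d)) :
    ⟪Matrix.toEuclideanLin B z, Matrix.toEuclideanLin B x - y⟫ = 0 := by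
  set K := LinearMap.range (Matrix.toEuclideanLin B) with hK
  have hmem : Matrix.toEuclideanLin B x ∈ K := LinearMap.mem_range_self _ x
  have hinf : ‖y - Matrix.toEuclideanLin B x‖ = ⨅ w : K, ‖y - w‖ := by
    refine le_antisymm (le_ciInf ?_) (ciInf_le ⟨0, ?_⟩ (⟨_, hmem⟩ : K))
    · rintro ⟨_, w, rfl⟩
      rw [norm_sub_rev, norm_sub_rev y]
      exact h w
    · rintro _ ⟨w, rfl⟩
      exact norm_nonneg _
  have := (K.norm_eq_iInf_iff_real_inner_eq_zero hmem).mp hinf _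
    (LinearMap.mem_range_self (Matrix.toEuclideanLin B) z)
  rw [real_inner_comm, ← neg_sub, inner_neg_left, this, neg_zero]

variable {m N d r : ℕ} {A : Matrix (Fin N) (Fin d) ℝ} {b : EuclideanSpace ℝ (Fin N)}

theorem projRange_add_projPerp (A : Matrix (Fin N) (Fin d) ℝ) (b : EuclideanSpace ℝ (Fin N)) :
    projRange A b + projPerp A b = b :=
  Submodule.starProjection_add_starProjection_orthogonal b

theorem projPerp_ne_zero (hb : b ∉ colSpace A) : projPerp A b ≠ 0 := by
  intro h
  have h1 := projRange_add_projPerp A b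
  rw [h, add_zero] at h1
  exact hb (h1 ▸ Submodule.starProjection_apply_mem _ b)

theorem residual_eq (A : Matrix (Fin N) (Fin d) ℝ) (b : EuclideanSpace ℝ (Fin N)) :
    residual A b = ‖projPerp A b‖ := by
  have h1 : projPerp A b = b - (colSpace A).starProjection b :=
    eq_sub_of_add_eq' (projRange_add_projPerp A b)
  rw [h1, Submodule.starProjection_minimal, residual]
  have hbdd : BddBelow (Set.range fun w : colSpace A => ‖b - w‖) :=
    ⟨0, by rintro _ ⟨w, rfl⟩; positivity⟩
  have hbdd' : BddBelow (Set.range fun x => ‖Matrix.toEuclideanLin A x - b‖) :=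
    ⟨0, by rintro _ ⟨w, rfl⟩; positivity⟩
  refine le_antisymm (le_ciInf ?_) (le_ciInf fun x => ?_)
  · rintro ⟨_, x, rfl⟩
    rw [norm_sub_rev]
    exact ciInf_le hbdd' x
  · rw [norm_sub_rev]
    exact ciInf_le hbdd (⟨_, LinearMap.mem_range_self _ x⟩ : colSpace A)

/-- On sketches that are injective on the column space, the squared optimality coefficient is a
function of the images of an orthonormal basis of the column space and of the normalised
residual. -/
theorem optimalityCoeff_sq_eq {e : Fin r → EuclideanSpace ℝ (Fin N)} (he : Orthonormal ℝ e)
    (hspan : Submodule.span ℝ (Set.range e) = colSpace A) {u : EuclideanSpace ℝ (Fin N)}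
    (hu : ‖u‖ = 1) (huA : u ∈ (colSpace A)ᗮ) {β : ℝ} (hβ : β ≠ 0) (hb : projPerp A b = β • u)
    {S : Matrix (Fin m) (Fin N) ℝ} {c : ℝ}
    (hLI : LinearIndependent ℝ fun k => c • Matrix.toEuclideanLin S (e k)) :
    optimalityCoeff A b S ^ 2 = projCoeffsSq (fun k => c • Matrix.toEuclideanLin S (e k))
      (c • Matrix.toEuclideanLin S u) := by
  set x := leastSquaresSolution (S * A) (Matrix.toEuclideanLin S b) with hx
  -- Only optimality is retained, not minimality of the norm: independence of the sketched basis
  -- already determines A x̂.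
  have hls : IsLeastSquaresSolution (S * A) (Matrix.toEuclideanLin S b) x :=
    (exists_minNorm_leastSquares (S * A) (Matrix.toEuclideanLin S b)).choose_spec.1
  set y := Matrix.toEuclideanLin A x - projRange A b with hy
  have hyA : y ∈ colSpace A :=
    sub_mem (LinearMap.mem_range_self _ x) (Submodule.starProjection_apply_mem _ b)
  have heA : ∀ k, e k ∈ colSpace A := fun k =>
    hspan ▸ Submodule.subset_span (Set.mem_range_self k)
  obtain ⟨a, ha⟩ : ∃ a : Fin r → ℝ, ∑ k, a k • e k = y := by
    rw [← hspan] at hyA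
    exact (Submodule.mem_span_range_iff_exists_fun ℝ).mp hyA
  have hAxb : Matrix.toEuclideanLin A x - b = y - β • u := by
    rw [hy, ← hb]
    nth_rewrite 1 [← projRange_add_projPerp A b]
    abel
  -- Since A x̂ - b = y - βu, the coordinates `a` of `y` solve the normal equations for fitting βSu
  -- by the S e_k. The scale `c` enters both sides as c².
  have hnormal : ∀ j, ⟪c • Matrix.toEuclideanLin S (e j),
      ∑ k, a k • c • Matrix.toEuclideanLin S (e k)⟫ =
      ⟪c • Matrix.toEuclideanLin S (e j), β • c • Matrix.toEuclideanLin S u⟫ := by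
    intro j
    obtain ⟨z, hz⟩ := heA j
    have h0 := hls.inner_eq_zero z
    rw [toEuclideanLin_mul_apply, toEuclideanLin_mul_apply, hz, ← map_sub, hAxb, map_sub,
      inner_sub_right, sub_eq_zero] at h0
    have hsum : ∑ k, a k • c • Matrix.toEuclideanLin S (e k) =
        c • Matrix.toEuclideanLin S y := by
      rw [← ha, map_sum, Finset.smul_sum]
      refine Finset.sum_congr rfl fun k _ => ?_
      rw [map_smul, smul_comm]
    rw [hsum, smul_comm β c, ← map_smul _ β, inner_smul_right, inner_smul_right, inner_smul_left,
      inner_smul_left, h0]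
  have hcoef := eq_projCoeffs hLI hnormal
  have hysq : ‖y‖ ^ 2 = β ^ 2 * projCoeffsSq (fun k => c • Matrix.toEuclideanLin S (e k))
      (c • Matrix.toEuclideanLin S u) := by
    rw [← projCoeffsSq_smul, projCoeffsSq, ← hcoef, ← ha, ← real_inner_self_eq_norm_sq,
      he.inner_sum]
    simp [dotProduct]
  have horth : ⟪y, β • u⟫ = 0 := by
    rw [inner_smul_right, Submodule.inner_right_of_mem_orthogonal hyA huA, mul_zero]
  have hsk : sketchedResidual S A b ^ 2 = ‖y‖ ^ 2 + β ^ 2 := by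
    rw [sketchedResidual, ← hx, hAxb, norm_sub_sq_real, horth, norm_smul, hu, mul_one,
      Real.norm_eq_abs, sq_abs]
    ring
  have hres : residual A b ^ 2 = β ^ 2 := by
    rw [residual_eq, hb, norm_smul, hu, mul_one, Real.norm_eq_abs, sq_abs]
  have hval : (sketchedResidual S A b ^ 2 - residual A b ^ 2) / residual A b ^ 2 =
      projCoeffsSq (fun k => c • Matrix.toEuclideanLin S (e k))
        (c • Matrix.toEuclideanLin S u) := by
    rw [hsk, hres, hysq]
    field_simp
    ring
  rw [optimalityCoeff, hval, Real.sq_sqrt (projCoeffsSq_nonneg _ _)]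

end LeastSquares

/-! ### Deterministic lower bounds for the squared cosine -/

section LowerBounds

variable {V : Type*} [NormedAddCommGroup V] [InnerProductSpace ℝ V]

/-- Write β = ‖p‖ and δ = ‖p - q‖. Cauchy–Schwarz gives ⟪p, q⟫ ≥ β² - βδ. If the right side is
nonnegative, squaring loses at most 2β³δ ≤ 2β²δ; otherwise the left side of the claim is at most 0.
Of √6 only √6 ≥ 2 is used. -/
theorem sq_sub_sqrt_six_mul_le (p q : V) (hp : ‖p‖ ≤ 1) :
    ‖p‖ ^ 4 - Real.sqrt 6 * ‖p - q‖ * ‖p‖ ^ 2 ≤ ⟪p, q⟫ ^ 2 := by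
  have h6 : 2 ≤ Real.sqrt 6 := Real.le_sqrt_of_sq_le (by norm_num)
  set β := ‖p‖
  set δ := ‖p - q‖
  have hβ : 0 ≤ β := norm_nonneg p
  have hδ : 0 ≤ δ := norm_nonneg _
  have hc : β ^ 2 - β * δ ≤ ⟪p, q⟫ := by
    have h := real_inner_le_norm p (p - q)
    rw [inner_sub_right, real_inner_self_eq_norm_sq] at h
    linarith
  have hδβ : 0 ≤ δ * β ^ 2 := by positivity
  rcases le_total (β * δ) (β ^ 2) with h | h
  · have h1 : (β ^ 2 - β * δ) ^ 2 ≤ ⟪p, q⟫ ^ 2 := pow_le_pow_left₀ (by linarith) hc 2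
    have h2 : 2 * (δ * β ^ 2) * β ≤ 2 * (δ * β ^ 2) := mul_le_of_le_one_right (by positivity) hp
    nlinarith [sq_nonneg (β * δ)]
  · have h1 : β ^ 4 ≤ (β * δ) * β ^ 2 := by nlinarith [sq_nonneg β]
    have h2 : (β * δ) * β ^ 2 ≤ δ * β ^ 2 := by nlinarith
    nlinarith [sq_nonneg ⟪p, q⟫]

/-- The squared cosine is unchanged under q ↦ -q, which accounts for the minimum over both signs. -/
theorem general_bound_le {p q : V} (hp : ‖p‖ ≤ 1) (hp0 : p ≠ 0) (hq0 : q ≠ 0) :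
    (‖p‖ ^ 2 - Real.sqrt 6 * min ‖p + q‖ ‖p - q‖) / ‖q‖ ^ 2 ≤
      (⟪p, q⟫ / (‖p‖ * ‖q‖)) ^ 2 := by
  have hpp : 0 < ‖p‖ := norm_pos_iff.mpr hp0
  have hqq : 0 < ‖q‖ := norm_pos_iff.mpr hq0
  have key : ‖p‖ ^ 4 - Real.sqrt 6 * min ‖p + q‖ ‖p - q‖ * ‖p‖ ^ 2 ≤ ⟪p, q⟫ ^ 2 := by
    rcases min_choice ‖p + q‖ ‖p - q‖ with h | h
    · rw [h]
      simpa using sq_sub_sqrt_six_mul_le p (-q) hp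
    · rw [h]
      exact sq_sub_sqrt_six_mul_le p q hp
  rw [div_pow, mul_pow, div_le_div_iff₀ (by positivity) (by positivity)]
  have := mul_le_mul_of_nonneg_right key (sq_nonneg ‖q‖)
  linarith

theorem norm_unitVec {N : ℕ} {v : EuclideanSpace ℝ (Fin N)} (hv : v ≠ 0) : ‖unitVec v‖ = 1 := by
  rw [unitVec, norm_smul, norm_inv, norm_norm, inv_mul_cancel₀ (norm_ne_zero_iff.mpr hv)]

variable {N d : ℕ} {A : Matrix (Fin N) (Fin d) ℝ} {b b' : EuclideanSpace ℝ (Fin N)}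

theorem norm_projPerp_le (A : Matrix (Fin N) (Fin d) ℝ) (v : EuclideanSpace ℝ (Fin N)) :
    ‖projPerp A v‖ ≤ ‖v‖ := Submodule.norm_starProjection_apply_le _ v

theorem norm_sq_eq_projRange_add_projPerp (A : Matrix (Fin N) (Fin d) ℝ)
    (v : EuclideanSpace ℝ (Fin N)) : ‖v‖ ^ 2 = ‖projRange A v‖ ^ 2 + ‖projPerp A v‖ ^ 2 :=
  Submodule.norm_sq_eq_add_norm_sq_starProjection v (colSpace A)

theorem relEnergy_eq (A : Matrix (Fin N) (Fin d) ℝ) (b : EuclideanSpace ℝ (Fin N)) :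
    relEnergy A b = ‖projRange A (unitVec b)‖ := by
  rw [relEnergy, projRange, projRange, unitVec, map_smul, norm_smul, norm_inv, norm_norm]
  ring

theorem absCorr_eq (b b' : EuclideanSpace ℝ (Fin N)) :
    absCorr b b' = |⟪unitVec b, unitVec b'⟫| := by
  rw [absCorr, unitVec, unitVec, inner_smul_left, inner_smul_right, abs_mul, abs_mul]
  simp [abs_inv]
  ring

/-- For the unit vectors p and q, ⟪p, q⟫ = ⟪Pp, q⟫ + ⟪p, P⊥q⟫, and the two terms are at most κ and
‖P⊥q‖ in absolute value. -/
theorem absCorr_sub_relEnergy_le (hb : b ≠ 0) (hb' : b' ≠ 0) :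
    absCorr b b' - relEnergy A b ≤ ‖projPerp A (unitVec b')‖ := by
  rw [absCorr_eq, relEnergy_eq]
  set p := unitVec b
  set q := unitVec b'
  have hp : ‖p‖ = 1 := norm_unitVec hb
  have hq : ‖q‖ = 1 := norm_unitVec hb'
  have h1 : ⟪p, q⟫ = ⟪projRange A p, q⟫ + ⟪p, projPerp A q⟫ := by
    nth_rewrite 1 [← projRange_add_projPerp A p]
    rw [inner_add_left]
    congr 1
    exact (colSpace A)ᗮ.inner_starProjection_left_eq_right p q
  have h2 := abs_real_inner_le_norm (projRange A p) q
  have h3 := abs_real_inner_le_norm p (projPerp A q)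
  rw [hq, mul_one] at h2
  rw [hp, one_mul] at h3
  rw [h1]
  linarith [abs_add_le ⟪projRange A p, q⟫ ⟪p, projPerp A q⟫]

theorem min_norm_add_sub_le {p q : V} (hp : ‖p‖ = 1) (hq : ‖q‖ = 1) :
    min ‖p + q‖ ‖p - q‖ ≤ Real.sqrt (2 * (1 - |⟪p, q⟫|)) := by
  rcases abs_cases ⟪p, q⟫ with ⟨h, -⟩ | ⟨h, -⟩
  · refine (min_le_right _ _).trans (Real.le_sqrt_of_sq_le ?_)
    rw [norm_sub_sq_real, hp, hq, h]
    linarith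
  · refine (min_le_left _ _).trans (Real.le_sqrt_of_sq_le ?_)
    rw [norm_add_sq_real, hp, hq, h]
    linarith

/-- Dividing 1 - κ² = ‖P⊥ b_P‖² by a number at most 1 only increases it. In the subtracted term the
projection contracts, √6 · √(2(1 - φ)) = √(12(1 - φ)), and the denominator is at least (φ - κ)². -/
theorem energy_bound_le (hb : b ∉ colSpace A) (hb' : b' ∉ colSpace A)
    (h : relEnergy A b < absCorr b b') :
    1 - relEnergy A b ^ 2 -
        Real.sqrt (12 * (1 - absCorr b b')) / (absCorr b b' - relEnergy A b) ^ 2 ≤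
      (‖projPerp A (unitVec b)‖ ^ 2 - Real.sqrt 6 *
          min ‖projPerp A (unitVec b + unitVec b')‖ ‖projPerp A (unitVec b - unitVec b')‖) /
        ‖projPerp A (unitVec b')‖ ^ 2 := by
  have hb0 : b ≠ 0 := fun h0 => hb (h0 ▸ zero_mem _)
  have hb0' : b' ≠ 0 := fun h0 => hb' (h0 ▸ zero_mem _)
  have hp := norm_unitVec hb0
  have hq := norm_unitVec hb0'
  have hle := absCorr_sub_relEnergy_le (A := A) hb0 hb0'
  have hpos : 0 < absCorr b b' - relEnergy A b := sub_pos.mpr h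
  have hq1 : ‖projPerp A (unitVec b')‖ ≤ 1 := hq ▸ norm_projPerp_le A _
  have hβ : 1 - relEnergy A b ^ 2 = ‖projPerp A (unitVec b)‖ ^ 2 := by
    have := norm_sq_eq_projRange_add_projPerp A (unitVec b)
    rw [hp, ← relEnergy_eq] at this
    linarith
  have hmin : Real.sqrt 6 *
      min ‖projPerp A (unitVec b + unitVec b')‖ ‖projPerp A (unitVec b - unitVec b')‖ ≤
      Real.sqrt (12 * (1 - absCorr b b')) := by
    rw [show 12 * (1 - absCorr b b') = 6 * (2 * (1 - absCorr b b')) by ring,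
      Real.sqrt_mul (by norm_num) (2 * (1 - absCorr b b'))]
    refine mul_le_mul_of_nonneg_left ?_ (Real.sqrt_nonneg 6)
    rw [absCorr_eq]
    exact (min_le_min (norm_projPerp_le A _) (norm_projPerp_le A _)).trans
      (min_norm_add_sub_le hp hq)
  have hqpos : 0 < ‖projPerp A (unitVec b')‖ := hpos.trans_le hle
  rw [hβ, sub_div]
  refine sub_le_sub ?_ ?_
  · rw [le_div_iff₀ (by positivity)]
    exact mul_le_of_le_one_right (sq_nonneg _) (pow_le_one₀ hqpos.le hq1)
  · exact div_le_div₀ (Real.sqrt_nonneg _) hmin (by positivity)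
      (pow_le_pow_left₀ hpos.le hle 2)

end LowerBounds

/-! ### Correlation of two optimality coefficients -/

section Correlation

theorem orthonormal_sumElim {V ι κ : Type*} [NormedAddCommGroup V] [InnerProductSpace ℝ V]
    {K : Submodule ℝ V} {e : ι → V} {f : κ → V} (he : Orthonormal ℝ e) (hf : Orthonormal ℝ f)
    (heK : ∀ i, e i ∈ K) (hfK : ∀ k, f k ∈ Kᗮ) : Orthonormal ℝ (Sum.elim e f) := by
  refine ⟨?_, ?_⟩
  · rintro (i | k)
    · exact he.1 i
    · exact hf.1 k
  · rintro (i | k) (j | l) h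
    · exact he.2 fun hij => h (congrArg _ hij)
    · exact Submodule.inner_right_of_mem_orthogonal (heK i) (hfK l)
    · exact Submodule.inner_left_of_mem_orthogonal (heK j) (hfK k)
    · exact hf.2 fun hkl => h (congrArg _ hkl)

theorem covariance_congr_ae {α : Type*} [MeasurableSpace α] {μ : Measure α} {X X' Y Y' : α → ℝ}
    (hX : X =ᵐ[μ] X') (hY : Y =ᵐ[μ] Y') : cov[X, Y; μ] = cov[X', Y'; μ] := by
  rw [covariance, covariance, integral_congr_ae hX, integral_congr_ae hY]
  refine integral_congr_ae ?_
  filter_upwards [hX, hY] with x h1 h2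
  rw [h1, h2]

variable {Ω : Type*} [MeasurableSpace Ω] {P : Measure Ω} {m N d : ℕ}
  {S : Ω → Matrix (Fin m) (Fin N) ℝ} {A : Matrix (Fin N) (Fin d) ℝ}
  {b : EuclideanSpace ℝ (Fin N)}

/-- An orthonormal basis of the column space. -/
noncomputable def colBasis (A : Matrix (Fin N) (Fin d) ℝ) :
    Fin (Module.finrank ℝ (colSpace A)) → EuclideanSpace ℝ (Fin N) :=
  fun k => (stdOrthonormalBasis ℝ (colSpace A) k : EuclideanSpace ℝ (Fin N))

theorem orthonormal_colBasis (A : Matrix (Fin N) (Fin d) ℝ) : Orthonormal ℝ (colBasis A) :=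
  (stdOrthonormalBasis ℝ (colSpace A)).orthonormal.comp_linearIsometry (colSpace A).subtypeₗᵢ

theorem colBasis_mem (A : Matrix (Fin N) (Fin d) ℝ) (k) : colBasis A k ∈ colSpace A :=
  Subtype.prop _

theorem span_colBasis (A : Matrix (Fin N) (Fin d) ℝ) :
    Submodule.span ℝ (Set.range (colBasis A)) = colSpace A := by
  have h := congrArg (Submodule.map (colSpace A).subtype)
    (stdOrthonormalBasis ℝ (colSpace A)).toBasis.span_eq
  rw [Submodule.map_span, ← Set.range_comp, Submodule.map_top, Submodule.range_subtype] at h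
  rwa [(stdOrthonormalBasis ℝ (colSpace A)).coe_toBasis] at h

theorem finrank_colSpace_pos (hA : A ≠ 0) : 0 < Module.finrank ℝ (colSpace A) := by
  rw [Module.finrank_pos_iff, Submodule.nontrivial_iff_ne_bot, colSpace, Ne,
    LinearMap.range_eq_bot]
  simpa using hA

/-- The rescaled sketch of the basis of the column space. -/
noncomputable def sketchedBasis (A : Matrix (Fin N) (Fin d) ℝ) (S : Matrix (Fin m) (Fin N) ℝ) :
    Fin (Module.finrank ℝ (colSpace A)) → EuclideanSpace ℝ (Fin m) :=
  fun k => Real.sqrt m • Matrix.toEuclideanLin S (colBasis A k)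

/-- The direction of the residual of `b`. -/
noncomputable def residualDir (A : Matrix (Fin N) (Fin d) ℝ) (b : EuclideanSpace ℝ (Fin N)) :
    EuclideanSpace ℝ (Fin N) :=
  ‖projPerp A (unitVec b)‖⁻¹ • projPerp A (unitVec b)

theorem projPerp_unitVec (A : Matrix (Fin N) (Fin d) ℝ) (b : EuclideanSpace ℝ (Fin N)) :
    projPerp A (unitVec b) = ‖b‖⁻¹ • projPerp A b := by
  rw [projPerp, projPerp, unitVec, map_smul]

theorem projPerp_unitVec_ne_zero (hb : b ∉ colSpace A) : projPerp A (unitVec b) ≠ 0 := by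
  have hb0 : b ≠ 0 := fun h0 => hb (h0 ▸ zero_mem _)
  rw [projPerp_unitVec]
  exact smul_ne_zero (inv_ne_zero (norm_ne_zero_iff.mpr hb0)) (projPerp_ne_zero hb)

theorem norm_residualDir (hb : b ∉ colSpace A) : ‖residualDir A b‖ = 1 := by
  rw [residualDir, norm_smul, norm_inv, norm_norm,
    inv_mul_cancel₀ (norm_ne_zero_iff.mpr (projPerp_unitVec_ne_zero hb))]

theorem residualDir_mem (A : Matrix (Fin N) (Fin d) ℝ) (b : EuclideanSpace ℝ (Fin N)) :
    residualDir A b ∈ (colSpace A)ᗮ :=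
  Submodule.smul_mem _ _ (Submodule.starProjection_apply_mem _ _)

theorem orthonormal_colBasis_unit {u : EuclideanSpace ℝ (Fin N)} (hu : ‖u‖ = 1)
    (huA : u ∈ (colSpace A)ᗮ) : Orthonormal ℝ (Sum.elim (colBasis A) fun _ : Unit => u) :=
  orthonormal_sumElim (orthonormal_colBasis A)
    ⟨fun _ => hu, fun i j h => absurd (Subsingleton.elim i j) h⟩ (colBasis_mem A) fun _ => huA

theorem orthonormal_colBasis_pair {u w : EuclideanSpace ℝ (Fin N)} (hu : ‖u‖ = 1) (hw : ‖w‖ = 1)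
    (huw : ⟪u, w⟫ = 0) (huA : u ∈ (colSpace A)ᗮ) (hwA : w ∈ (colSpace A)ᗮ) :
    Orthonormal ℝ (Sum.elim (colBasis A) ![u, w]) := by
  refine orthonormal_sumElim (orthonormal_colBasis A) ⟨?_, ?_⟩ (colBasis_mem A) ?_
  · intro i
    fin_cases i <;> simpa
  · intro i j h
    fin_cases i <;> fin_cases j <;> simp_all [real_inner_comm]
  · intro i
    fin_cases i <;> simpa

theorem ae_optimalityCoeff_sq_eq (hS : IsGaussianSketch S P) (hm0 : 0 < m)
    (hm : Module.finrank ℝ (colSpace A) ≤ m) (hb : b ∉ colSpace A) :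
    (fun ω => optimalityCoeff A b (S ω) ^ 2) =ᵐ[P] fun ω =>
      projCoeffsSq (sketchedBasis A (S ω))
        (Real.sqrt m • Matrix.toEuclideanLin (S ω) (residualDir A b)) := by
  have hlaw := hS.hasLaw_apply_orthonormal hm0 (orthonormal_colBasis A)
  have hLI := ae_linearIndependent (E := EuclideanSpace ℝ (Fin m))
    (r := Module.finrank ℝ (colSpace A)) (by simpa using hm)
  rw [← hlaw.map_eq, ae_map_iff hlaw.aemeasurable measurableSet_linearIndependent] at hLI
  have hb0 : b ≠ 0 := fun h0 => hb (h0 ▸ zero_mem _)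
  filter_upwards [hLI] with ω hω
  refine optimalityCoeff_sq_eq (orthonormal_colBasis A) (span_colBasis A) (norm_residualDir hb)
    -- This `β` equals ‖P⊥ b‖; it appears as a product because `residualDir` is built from the unit
    -- vector of `b`.
    (residualDir_mem A b) (β := ‖b‖ * ‖projPerp A (unitVec b)‖) ?_ ?_ hω
  · exact mul_ne_zero (norm_ne_zero_iff.mpr hb0)
      (norm_ne_zero_iff.mpr (projPerp_unitVec_ne_zero hb))
  · rw [residualDir, smul_smul, mul_assoc, mul_inv_cancel₀
      (norm_ne_zero_iff.mpr (projPerp_unitVec_ne_zero hb)), mul_one, projPerp_unitVec, smul_smul,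
      mul_inv_cancel₀ (norm_ne_zero_iff.mpr hb0), one_smul]

/-- The variance of the squared coefficient vector of a standard Gaussian vector with respect to
`r` independent standard Gaussian vectors in dimension `m`. -/
noncomputable def modelVar (r m : ℕ) : ℝ :=
  Var[fun x : (Fin r → EuclideanSpace ℝ (Fin m)) × EuclideanSpace ℝ (Fin m) =>
    projCoeffsSq x.1 x.2; (Measure.pi fun _ : Fin r => stdGaussian (EuclideanSpace ℝ (Fin m))).prod
      (stdGaussian (EuclideanSpace ℝ (Fin m)))]

theorem memLp_optimalityCoeff_sq (hm : Module.finrank ℝ (colSpace A) + 8 ≤ m)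
    (hS : IsGaussianSketch S P) (hb : b ∉ colSpace A) :
    MemLp (fun ω => optimalityCoeff A b (S ω) ^ 2) 2 P := by
  rw [memLp_congr_ae (ae_optimalityCoeff_sq_eq hS (by omega) (by omega) hb)]
  have hlaw := hS.hasLaw_pair (by omega)
    (orthonormal_colBasis_unit (norm_residualDir hb) (residualDir_mem A b))
  have h := memLp_projCoeffsSq (E := EuclideanSpace ℝ (Fin m))
    (r := Module.finrank ℝ (colSpace A)) (by simpa using hm)
  rw [← hlaw.map_eq] at h
  have h2 := h.comp_of_map hlaw.aemeasurable
  simp only [Function.comp_def] at h2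
  exact h2

/-- The value does not involve `b`, so the denominator of Pearson's coefficient collapses to a
single variance. -/
theorem variance_optimalityCoeff_sq (hm : Module.finrank ℝ (colSpace A) + 8 ≤ m)
    (hS : IsGaussianSketch S P) (hb : b ∉ colSpace A) :
    Var[fun ω => optimalityCoeff A b (S ω) ^ 2; P] =
      modelVar (Module.finrank ℝ (colSpace A)) m := by
  rw [variance_congr (ae_optimalityCoeff_sq_eq hS (by omega) (by omega) hb)]
  have hlaw := hS.hasLaw_pair (by omega)
    (orthonormal_colBasis_unit (norm_residualDir hb) (residualDir_mem A b))
  have h := variance_map (X := fun x : (Fin (Module.finrank ℝ (colSpace A)) →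
    EuclideanSpace ℝ (Fin m)) × EuclideanSpace ℝ (Fin m) => projCoeffsSq x.1 x.2)
    (measurable_fst.projCoeffsSq measurable_snd).aemeasurable hlaw.aemeasurable
  rw [hlaw.map_eq] at h
  rw [modelVar, h]
  rfl

theorem sq_mul_modelVar_le_covariance (hm : Module.finrank ℝ (colSpace A) + 8 ≤ m)
    (hS : IsGaussianSketch S P) (hb : b ∉ colSpace A)
    {b' : EuclideanSpace ℝ (Fin N)} (hb' : b' ∉ colSpace A) :
    ⟪residualDir A b, residualDir A b'⟫ ^ 2 * modelVar (Module.finrank ℝ (colSpace A)) m ≤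
      cov[fun ω => optimalityCoeff A b (S ω) ^ 2,
        fun ω => optimalityCoeff A b' (S ω) ^ 2; P] := by
  have hX := ae_optimalityCoeff_sq_eq hS (by omega) (by omega) hb
  have hY := ae_optimalityCoeff_sq_eq hS (by omega) (by omega) hb'
  have hu := norm_residualDir hb
  have huA := residualDir_mem A b
  have hvA := residualDir_mem A b'
  set u := residualDir A b
  set v := residualDir A b'
  set ρ := ⟪u, v⟫ with hρ
  have hwA : v - ρ • u ∈ (colSpace A)ᗮ := sub_mem hvA (Submodule.smul_mem _ _ huA)
  -- If the residual directions are parallel there is no second direction `w` to normalise; then the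
  -- second variable is almost surely ρ² times the first and equality holds.
  rcases eq_or_ne (v - ρ • u) 0 with h0 | h0
  · have hv : v = ρ • u := sub_eq_zero.mp h0
    have hXm := (memLp_optimalityCoeff_sq hm hS hb).aestronglyMeasurable.aemeasurable
    have hYX : (fun ω => optimalityCoeff A b' (S ω) ^ 2) =ᵐ[P]
        fun ω => ρ ^ 2 * optimalityCoeff A b (S ω) ^ 2 := by
      filter_upwards [hX, hY] with ω h1 h2
      rw [h1, h2, ← projCoeffsSq_smul, hv, map_smul, smul_comm]
    rw [covariance_congr_ae (ae_eq_refl _) hYX, covariance_const_mul_right, covariance_self hXm,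
      variance_optimalityCoeff_sq hm hS hb]
  · set t := ‖v - ρ • u‖ with ht
    have ht0 : t ≠ 0 := norm_ne_zero_iff.mpr h0
    set w := t⁻¹ • (v - ρ • u) with hw
    have hw1 : ‖w‖ = 1 := by
      rw [hw, norm_smul, norm_inv, ht, norm_norm, inv_mul_cancel₀ ht0]
    have huw : ⟪u, w⟫ = 0 := by
      rw [hw, inner_smul_right, inner_sub_right, inner_smul_right, real_inner_self_eq_norm_sq, hu,
        ← hρ]
      ring
    have hv : v = ρ • u + t • w := by
      rw [hw, smul_smul, mul_inv_cancel₀ ht0, one_smul, add_sub_cancel]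
    have hlaw := hS.hasLaw_triple (by omega)
      (orthonormal_colBasis_pair hu hw1 huw huA (Submodule.smul_mem _ _ hwA))
    have hXm : Measurable fun x : (Fin (Module.finrank ℝ (colSpace A)) →
        EuclideanSpace ℝ (Fin m)) × EuclideanSpace ℝ (Fin m) × EuclideanSpace ℝ (Fin m) =>
        projCoeffsSq x.1 x.2.1 := measurable_fst.projCoeffsSq measurable_snd.fst
    have hYm : Measurable fun x : (Fin (Module.finrank ℝ (colSpace A)) →
        EuclideanSpace ℝ (Fin m)) × EuclideanSpace ℝ (Fin m) × EuclideanSpace ℝ (Fin m) =>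
        projCoeffsSq x.1 (ρ • x.2.1 + t • x.2.2) :=
      measurable_fst.projCoeffsSq (by fun_prop)
    have hcov := hlaw.covariance_fun_comp hXm.aemeasurable hYm.aemeasurable
    have hge := covariance_projCoeffsSq_ge (E := EuclideanSpace ℝ (Fin m))
      (r := Module.finrank ℝ (colSpace A)) (by simpa using hm) ρ t
    rw [← hcov] at hge
    refine hge.trans_eq (covariance_congr_ae hX.symm ?_)
    filter_upwards [hY] with ω h1
    rw [h1, hv, map_add, map_smul _ ρ u, map_smul _ t w, smul_add, smul_comm ρ, smul_comm t]
    rfl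

theorem sq_inner_residualDir_le_pearsonCorr (hm : Module.finrank ℝ (colSpace A) + 8 ≤ m)
    (hA : A ≠ 0) (hS : IsGaussianSketch S P) (hb : b ∉ colSpace A)
    {b' : EuclideanSpace ℝ (Fin N)} (hb' : b' ∉ colSpace A) :
    ⟪residualDir A b, residualDir A b'⟫ ^ 2 ≤
      pearsonCorr (fun ω => optimalityCoeff A b (S ω) ^ 2)
        (fun ω => optimalityCoeff A b' (S ω) ^ 2) P := by
  have hpos : 0 < modelVar (Module.finrank ℝ (colSpace A)) m :=
    variance_projCoeffsSq_pos (finrank_colSpace_pos hA) (by simpa using hm)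
  rw [pearsonCorr, variance_optimalityCoeff_sq hm hS hb, variance_optimalityCoeff_sq hm hS hb',
    Real.sqrt_mul_self hpos.le, le_div_iff₀ hpos]
  exact sq_mul_modelVar_le_covariance hm hS hb hb'

end Correlation

end BiFidelity

/-! ### The limit statements -/

theorem mainTheorem3 {N d : ℕ} (A : Matrix (Fin N) (Fin d) ℝ) (hA : A ≠ 0)
    (b b' : EuclideanSpace ℝ (Fin N))
    (hb : b ∉ BiFidelity.colSpace A) (hb' : b' ∉ BiFidelity.colSpace A)
    {Ω : ℕ → Type*} [∀ m, MeasurableSpace (Ω m)]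
    (P : ∀ m, Measure (Ω m)) [∀ m, IsProbabilityMeasure (P m)]
    (S : ∀ m, Ω m → Matrix (Fin m) (Fin N) ℝ)
    (hS : ∀ m, BiFidelity.IsGaussianSketch (S m) (P m)) :
    -- the correlation is well defined for all large `m`
    (∀ᶠ m in atTop,
      (MemLp (fun ω => BiFidelity.optimalityCoeff A b (S m ω) ^ 2) 2 (P m) ∧
        0 < Var[fun ω => BiFidelity.optimalityCoeff A b (S m ω) ^ 2; P m]) ∧
      (MemLp (fun ω => BiFidelity.optimalityCoeff A b' (S m ω) ^ 2) 2 (P m) ∧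
        0 < Var[fun ω => BiFidelity.optimalityCoeff A b' (S m ω) ^ 2; P m])) ∧
    -- the general lower bound
    (((‖BiFidelity.projPerp A (BiFidelity.unitVec b)‖ ^ 2 -
        Real.sqrt 6 *
          min ‖BiFidelity.projPerp A (BiFidelity.unitVec b + BiFidelity.unitVec b')‖
            ‖BiFidelity.projPerp A (BiFidelity.unitVec b - BiFidelity.unitVec b')‖) /
        ‖BiFidelity.projPerp A (BiFidelity.unitVec b')‖ ^ 2 : ℝ) : EReal) ≤
      liminf (fun m => (BiFidelity.pearsonCorr
        (fun ω => BiFidelity.optimalityCoeff A b (S m ω) ^ 2)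
        (fun ω => BiFidelity.optimalityCoeff A b' (S m ω) ^ 2) (P m) : EReal)) atTop ∧
    -- the lower bound in terms of `φ` and `κ`
    (BiFidelity.relEnergy A b < BiFidelity.absCorr b b' →
      ((1 - BiFidelity.relEnergy A b ^ 2 -
          Real.sqrt (12 * (1 - BiFidelity.absCorr b b')) /
            (BiFidelity.absCorr b b' - BiFidelity.relEnergy A b) ^ 2 : ℝ) : EReal) ≤
        liminf (fun m => (BiFidelity.pearsonCorr
          (fun ω => BiFidelity.optimalityCoeff A b (S m ω) ^ 2)
          (fun ω => BiFidelity.optimalityCoeff A b' (S m ω) ^ 2) (P m) : EReal)) atTop) := by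
  have hlarge : ∀ᶠ m in atTop, Module.finrank ℝ (BiFidelity.colSpace A) + 8 ≤ m :=
    eventually_ge_atTop _
  have hgen : ((‖BiFidelity.projPerp A (BiFidelity.unitVec b)‖ ^ 2 -
        Real.sqrt 6 *
          min ‖BiFidelity.projPerp A (BiFidelity.unitVec b + BiFidelity.unitVec b')‖
            ‖BiFidelity.projPerp A (BiFidelity.unitVec b - BiFidelity.unitVec b')‖) /
        ‖BiFidelity.projPerp A (BiFidelity.unitVec b')‖ ^ 2 : ℝ) ≤
      inner ℝ (BiFidelity.residualDir A b) (BiFidelity.residualDir A b') ^ 2 := by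
    have hp1 : ‖BiFidelity.projPerp A (BiFidelity.unitVec b)‖ ≤ 1 := by
      have hb0 : b ≠ 0 := fun h0 => hb (h0 ▸ zero_mem _)
      exact (BiFidelity.norm_projPerp_le A _).trans (BiFidelity.norm_unitVec hb0).le
    have h := BiFidelity.general_bound_le hp1 (BiFidelity.projPerp_unitVec_ne_zero hb)
      (BiFidelity.projPerp_unitVec_ne_zero hb')
    have hadd : BiFidelity.projPerp A (BiFidelity.unitVec b + BiFidelity.unitVec b') =
        BiFidelity.projPerp A (BiFidelity.unitVec b) +
          BiFidelity.projPerp A (BiFidelity.unitVec b') := map_add _ _ _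
    have hsub : BiFidelity.projPerp A (BiFidelity.unitVec b - BiFidelity.unitVec b') =
        BiFidelity.projPerp A (BiFidelity.unitVec b) -
          BiFidelity.projPerp A (BiFidelity.unitVec b') := map_sub _ _ _
    rw [hadd, hsub]
    refine h.trans_eq ?_
    rw [BiFidelity.residualDir, BiFidelity.residualDir, inner_smul_left, inner_smul_right]
    simp only [conj_trivial]
    congr 1
    field_simp
  -- The bound ρ² holds for every m ≥ r + 8, so it passes to the lower limit, taken in `EReal`,
  -- where no boundedness has to be checked.
  have hliminf : ((inner ℝ (BiFidelity.residualDir A b) (BiFidelity.residualDir A b') ^ 2 : ℝ) :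
      EReal) ≤ liminf (fun m => (BiFidelity.pearsonCorr
        (fun ω => BiFidelity.optimalityCoeff A b (S m ω) ^ 2)
        (fun ω => BiFidelity.optimalityCoeff A b' (S m ω) ^ 2) (P m) : EReal)) atTop := by
    refine le_liminf_of_le (by isBoundedDefault) ?_
    filter_upwards [hlarge] with m hm
    exact EReal.coe_le_coe_iff.mpr
      (BiFidelity.sq_inner_residualDir_le_pearsonCorr hm hA (hS m) hb hb')
  refine ⟨?_, (EReal.coe_le_coe_iff.mpr hgen).trans hliminf, fun h =>
    (EReal.coe_le_coe_iff.mpr ((BiFidelity.energy_bound_le hb hb' h).trans hgen)).trans hliminf⟩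
  filter_upwards [hlarge] with m hm
  have hpos : 0 < BiFidelity.modelVar (Module.finrank ℝ (BiFidelity.colSpace A)) m :=
    BiFidelity.variance_projCoeffsSq_pos (BiFidelity.finrank_colSpace_pos hA) (by simpa using hm)
  exact ⟨⟨BiFidelity.memLp_optimalityCoeff_sq hm (hS m) hb,
      (BiFidelity.variance_optimalityCoeff_sq hm (hS m) hb).symm ▸ hpos⟩,
    BiFidelity.memLp_optimalityCoeff_sq hm (hS m) hb',
    (BiFidelity.variance_optimalityCoeff_sq hm (hS m) hb').symm ▸ hpos⟩
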